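/- **Conventions.** Let $K$ be a field. A $K$-linear 2-category is a (strict) 2-category whose hom-categories are $K$-linear and whose composition functors are $K$-bilinear on 2-morphisms. Vertical composition of 2-morphisms is written $\cdot$, horizontal composition $\circ$. A pseudofunctor $\mathcal F:\mathfrak C\to\mathfrak D$ has structure 2-isomorphisms $\widehat{\mathcal F}(f,g):\mathcal F(g)\circ\mathcal F(f)\Rightarrow\mathcal F(g\circ f)$, natural in $f$ and $g$, and $\mathcal F_0(X):\mathcal F(\mathrm{id}_X)\Rightarrow\mathrm{id}_{\mathcal F(X)}$, subject to the composition axiom $\widehat{\mathcal F}(g\circ f,l)\cdot(1_{\mathcal F(l)}\circ\widehat{\mathcal F}(f,g))=\widehat{\mathcal F}(f,l\circ g)\cdot(\widehat{\mathcal F}(g,l)\circ 1_{\mathcal F(f)})$ and to the two unit axioms $\widehat{\mathcal F}(\mathrm{id}_X,f)=1_{\mathcal F(f)}\circ\mathcal F_0(X)$, $\widehat{\mathcal F}(f,\mathrm{id}_Y)=\mathcal F_0(Y)\circ 1_{\mathcal F(f)}$ for $f:X\to Y$. It is $K$-linear if it is $K$-linear on 2-morphisms, and unitary if all $\mathcal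 F_0(X)$ are identities. For $n\ge 0$ let $\mathfrak C[h]/(h^{n+1})$ be the 2-category with the objects and 1-morphisms of $\mathfrak C$ whose 2-morphisms are polynomials $\sum_{k=0}^n\tau_kh^k$ with coefficients parallel 2-morphisms of $\mathfrak C$, composed as polynomials modulo $h^{n+1}$. A *purely pseudofunctorial $n$-th order deformation* of a $K$-linear pseudofunctor $\mathcal F:\mathfrak C\to\mathfrak D$ is a pseudofunctor $\mathfrak C[h]/(h^{n+1})\to\mathfrak D[h]/(h^{n+1})$ which acts as $\mathcal F$ on objects and 1-morphisms and by $\sum_k\tau_kh^k\mapsto\sum_k\mathcal F(\tau_k)h^k$ on 2-morphisms, with structure 2-isomorphisms $\sum_{k=0}^n\widehat{\mathcal F}^k(f,g)h^k$ and $\sum_{k=0}^n\mathcal F_0^k(X)h^k$, where $\widehat{\mathcal F}^0=\widehat{\mathcal F}$ and $\mathcal F^0_0=\mathcal F_0$. An $(n+1)$-th order deformation *extends* it if it has the same $\widehat{\mathcal F}^k$ and $\mathcal F_0^k$ for all $k\le n$. For $m=2,3,4$ let $X^m(\mathcal F)$ be the $K$-vector space of families $\phi$ of 2-morphisms $\phi(f_0,\dots,f_{m-1}):\mathcal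 F(f_{m-1})\circ\cdots\circ\mathcal F(f_0)\Rightarrow\mathcal F(f_{m-1}\circ\cdots\circ f_0)$, one for each path $X_0\xrightarrow{f_0}X_1\to\cdots\xrightarrow{f_{m-1}}X_m$ of 1-morphisms of $\mathfrak C$, natural in $f_0,\dots,f_{m-1}$. The coboundary $\delta:X^m(\mathcal F)\to X^{m+1}(\mathcal F)$, $m=2,3$, of the deformation complex $X^\bullet(\mathcal F)$ is $$\delta\phi(f_0,\dots,f_m)=\lceil\phi(f_1,\dots,f_m)\circ 1_{\mathcal F(f_0)}\rceil+\sum_{i=1}^m(-1)^i\lceil\phi(f_0,\dots,f_i\circ f_{i-1},\dots,f_m)\rceil+(-1)^{m+1}\lceil 1_{\mathcal F(f_m)}\circ\phi(f_0,\dots,f_{m-1})\rceil,$$ where $\lceil-\rceil$ means that one composes vertically with the unique 2-morphisms built from $\widehat{\mathcal F}$ so that the result is a 2-morphism $\mathcal F(f_m)\circ\cdots\circ\mathcal F(f_0)\Rightarrow\mathcal F(f_m\circ\cdots\circ f_0)$. One has $\delta\delta=0$; $H^3(\mathcal F)$ is the quotient of $\ker(\delta:X^3(\mathcal F)\to X^4(\mathcal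 F))$ by $\delta(X^2(\mathcal F))$. **Theorem 8.1.** Let $\mathfrak C,\mathfrak D$ be $K$-linear 2-categories, let $\mathcal F:\mathfrak C\to\mathfrak D$ be a $K$-linear unitary pseudofunctor, and let a purely pseudofunctorial $n$-th order deformation of $\mathcal F$ be given, with families $\widehat{\mathcal F}^k$, $0\le k\le n$. Define $\Psi\in X^3(\mathcal F)$ by $$\Psi(f,g,l)=\sum_{\substack{p+q=n+1\\0\le p,q\le n}}\widehat{\mathcal F}^p(g\circ f,l)\cdot\bigl(1_{\mathcal F(l)}\circ\widehat{\mathcal F}^q(f,g)\bigr)-\sum_{\substack{p+q=n+1\\0\le p,q\le n}}\widehat{\mathcal F}^p(f,l\circ g)\cdot\bigl(\widehat{\mathcal F}^q(g,l)\circ 1_{\mathcal F(f)}\bigr).$$ Then: 1. $\delta\Psi=0$, that is, $\Psi$ is a 3-cocycle of $X^\bullet(\mathcal F)$. 2. $\Psi$ is the obstruction to extending the deformation to order $n+1$: for $\phi\in X^2(\mathcal F)$, there is a purely pseudofunctorial $(n+1)$-th order deformation of $\mathcal F$ that extends the given one and has $\widehat{\mathcal F}^{n+1}=\phi$ if and only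 if $\delta\phi=\Psi$. 3. If the class of $\Psi$ in $H^3(\mathcal F)$ is zero, then there is a purely pseudofunctorial $(n+1)$-th order deformation of $\mathcal F$ that extends the given one. -/

import Mathlib

open CategoryTheory Bicategory
open Finset.HasAntidiagonal (antidiagonal mem_antidiagonal)

attribute [-instance] CategoryTheory.catToReflQuiver

namespace PseudoDeformation

set_option linter.unusedSectionVars false
set_option linter.unusedSimpArgs false

universe w₁ w₂ v₁ v₂ u₁ u₂ uK

/-- The hom-categories are preadditive and the composition functors are biadditive on
2-morphisms. -/
class PreadditiveBicategory (B : Type u₁) [Bicategory.{w₁, v₁} B] where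
  preadditive (X Y : B) : Preadditive (X ⟶ Y)
  whiskerLeft_add {X Y Z : B} (f : X ⟶ Y) {g g' : Y ⟶ Z} (η θ : g ⟶ g') :
    f ◁ (η + θ) = f ◁ η + f ◁ θ
  add_whiskerRight {X Y Z : B} {f f' : X ⟶ Y} (η θ : f ⟶ f') (g : Y ⟶ Z) :
    (η + θ) ▷ g = η ▷ g + θ ▷ g

attribute [reducible, instance] PreadditiveBicategory.preadditive
attribute [simp] PreadditiveBicategory.whiskerLeft_add PreadditiveBicategory.add_whiskerRight

/-- The hom-categories are `K`-linear and the composition functors are `K`-bilinear on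
2-morphisms. A `K`-linear 2-category is a strict bicategory with this structure. -/
class LinearBicategory (K : Type uK) [Field K] (B : Type u₁) [Bicategory.{w₁, v₁} B]
    [PreadditiveBicategory B] where
  linear (X Y : B) : Linear K (X ⟶ Y)
  whiskerLeft_smul {X Y Z : B} (f : X ⟶ Y) {g g' : Y ⟶ Z} (r : K) (η : g ⟶ g') :
    f ◁ (r • η) = r • f ◁ η
  smul_whiskerRight {X Y Z : B} {f f' : X ⟶ Y} (r : K) (η : f ⟶ f') (g : Y ⟶ Z) :
    (r • η) ▷ g = r • η ▷ g

attribute [reducible, instance] LinearBicategory.linear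
attribute [simp] LinearBicategory.whiskerLeft_smul LinearBicategory.smul_whiskerRight

section Whisker

variable {B : Type u₁} [Bicategory.{w₁, v₁} B] [PreadditiveBicategory B]

/-- Left whiskering as an additive map. -/
def whiskerLeftHom {X Y Z : B} (f : X ⟶ Y) (g g' : Y ⟶ Z) : (g ⟶ g') →+ (f ≫ g ⟶ f ≫ g') :=
  AddMonoidHom.mk' (fun η => f ◁ η) (PreadditiveBicategory.whiskerLeft_add f)

/-- Right whiskering as an additive map. -/
def whiskerRightHom {X Y Z : B} (f f' : X ⟶ Y) (g : Y ⟶ Z) : (f ⟶ f') →+ (f ≫ g ⟶ f' ≫ g) :=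
  AddMonoidHom.mk' (fun η => η ▷ g) (fun η θ => PreadditiveBicategory.add_whiskerRight η θ g)

@[simp] lemma whiskerLeft_zero {X Y Z : B} (f : X ⟶ Y) (g g' : Y ⟶ Z) :
    f ◁ (0 : g ⟶ g') = 0 := (whiskerLeftHom f g g').map_zero

@[simp] lemma zero_whiskerRight {X Y Z : B} (f f' : X ⟶ Y) (g : Y ⟶ Z) :
    (0 : f ⟶ f') ▷ g = 0 := (whiskerRightHom f f' g).map_zero

@[simp] lemma whiskerLeft_sub {X Y Z : B} (f : X ⟶ Y) {g g' : Y ⟶ Z} (η θ : g ⟶ g') :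
    f ◁ (η - θ) = f ◁ η - f ◁ θ := (whiskerLeftHom f g g').map_sub η θ

@[simp] lemma sub_whiskerRight {X Y Z : B} {f f' : X ⟶ Y} (η θ : f ⟶ f') (g : Y ⟶ Z) :
    (η - θ) ▷ g = η ▷ g - θ ▷ g := (whiskerRightHom f f' g).map_sub η θ

@[simp] lemma whiskerLeft_sum {X Y Z : B} (f : X ⟶ Y) {g g' : Y ⟶ Z} {ι : Type*}
    (s : Finset ι) (η : ι → (g ⟶ g')) :
    f ◁ (∑ i ∈ s, η i) = ∑ i ∈ s, f ◁ η i := map_sum (whiskerLeftHom f g g') η s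

@[simp] lemma sum_whiskerRight {X Y Z : B} {f f' : X ⟶ Y} {ι : Type*}
    (s : Finset ι) (η : ι → (f ⟶ f')) (g : Y ⟶ Z) :
    (∑ i ∈ s, η i) ▷ g = ∑ i ∈ s, η i ▷ g := map_sum (whiskerRightHom f f' g) η s

end Whisker

/-- A pseudofunctor between `K`-linear bicategories is `K`-linear if it is `K`-linear on
2-morphisms. -/
class LinearPseudofunctor (K : Type uK) [Field K] {B : Type u₁} [Bicategory.{w₁, v₁} B]
    [PreadditiveBicategory B] [LinearBicategory K B] {C : Type u₂} [Bicategory.{w₂, v₂} C]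
    [PreadditiveBicategory C] [LinearBicategory K C] (F : Pseudofunctor B C) : Prop where
  map₂_add {X Y : B} {f g : X ⟶ Y} (η θ : f ⟶ g) : F.map₂ (η + θ) = F.map₂ η + F.map₂ θ
  map₂_smul {X Y : B} {f g : X ⟶ Y} (r : K) (η : f ⟶ g) : F.map₂ (r • η) = r • F.map₂ η

/-! ### The truncated polynomial extension of a 2-category -/

/-- Objects of the extension `B[h]/(h^{n+1})` of `B`: the objects of `B`. -/
structure TruncExt (n : ℕ) (B : Type u₁) where
  obj : B

namespace TruncExt

variable {n : ℕ} {B : Type u₁} [Bicategory.{w₁, v₁} B] [PreadditiveBicategory B]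

/-- 1-morphisms of `B[h]/(h^{n+1})`: the 1-morphisms of `B`. -/
structure Hom (X Y : TruncExt n B) where
  hom : X.obj ⟶ Y.obj

/-- 2-morphisms of `B[h]/(h^{n+1})`: polynomials `∑_{k ≤ n} τ_k h^k` in `h` whose coefficients
are 2-morphisms of `B`. -/
@[ext]
structure Hom₂ {X Y : TruncExt n B} (f g : Hom X Y) where
  coeff : ℕ → (f.hom ⟶ g.hom)
  coeff_eq_zero (k : ℕ) (hk : n < k) : coeff k = 0

/-- The constant polynomial `τ + 0 h + ... `. -/
@[simps]
def const {X Y : TruncExt n B} {f g : Hom X Y} (τ : f.hom ⟶ g.hom) : Hom₂ f g where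
  coeff k := if k = 0 then τ else 0
  coeff_eq_zero k hk := if_neg (by omega)

/-- Vertical composition: the product of polynomials modulo `h^{n+1}`. -/
@[simps]
def vcomp {X Y : TruncExt n B} {f g l : Hom X Y} (σ : Hom₂ f g) (τ : Hom₂ g l) : Hom₂ f l where
  coeff k := if k ≤ n then ∑ p ∈ antidiagonal k, σ.coeff p.1 ≫ τ.coeff p.2 else 0
  coeff_eq_zero k hk := if_neg (by omega)

lemma const_vcomp {X Y : TruncExt n B} {f g l : Hom X Y} (σ : f.hom ⟶ g.hom) (τ : Hom₂ g l)
    (k : ℕ) : (vcomp (const σ) τ).coeff k = σ ≫ τ.coeff k := by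
  rw [vcomp_coeff]
  split_ifs with hk
  · rw [Finset.sum_eq_single (0, k)]
    · simp
    · rintro ⟨a, b⟩ hab hne
      have : a ≠ 0 := by
        rintro rfl
        simp at hab
        exact hne (by simp [hab])
      simp [this]
    · simp
  · rw [τ.coeff_eq_zero k (by omega), Limits.comp_zero]

lemma vcomp_const {X Y : TruncExt n B} {f g l : Hom X Y} (σ : Hom₂ f g) (τ : g.hom ⟶ l.hom)
    (k : ℕ) : (vcomp σ (const τ)).coeff k = σ.coeff k ≫ τ := by
  rw [vcomp_coeff]
  split_ifs with hk
  · rw [Finset.sum_eq_single (k, 0)]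
    · simp
    · rintro ⟨a, b⟩ hab hne
      have : b ≠ 0 := by
        rintro rfl
        simp at hab
        exact hne (by simp [hab])
      simp [this]
    · simp
  · rw [σ.coeff_eq_zero k (by omega), Limits.zero_comp]

lemma vcomp_assoc {X Y : TruncExt n B} {f g l m : Hom X Y} (σ : Hom₂ f g) (τ : Hom₂ g l)
    (ρ : Hom₂ l m) : vcomp (vcomp σ τ) ρ = vcomp σ (vcomp τ ρ) := by
  ext k
  simp only [vcomp_coeff]
  split_ifs with hk
  · have h₁ : ∀ p ∈ antidiagonal k, p.1 ≤ n ∧ p.2 ≤ n := fun p hp => by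
      have := mem_antidiagonal.mp hp; omega
    trans ∑ p ∈ antidiagonal k, ∑ q ∈ antidiagonal p.1,
        σ.coeff q.1 ≫ τ.coeff q.2 ≫ ρ.coeff p.2
    · refine Finset.sum_congr rfl fun p hp => ?_
      simp [(h₁ p hp).1, Preadditive.sum_comp]
    trans ∑ p ∈ antidiagonal k, ∑ q ∈ antidiagonal p.2,
        σ.coeff p.1 ≫ τ.coeff q.1 ≫ ρ.coeff q.2
    · rw [Finset.sum_sigma', Finset.sum_sigma']
      refine Finset.sum_bij' (fun x _ => ⟨(x.2.1, x.2.2 + x.1.2), (x.2.2, x.1.2)⟩)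
        (fun x _ => ⟨(x.1.1 + x.2.1, x.2.2), (x.1.1, x.2.1)⟩) ?_ ?_ ?_ ?_ ?_ <;>
      · rintro ⟨⟨a, b⟩, ⟨c, d⟩⟩ h
        simp only [Finset.mem_sigma, mem_antidiagonal] at h
        obtain ⟨rfl, rfl⟩ := h
        simp [add_assoc]
    · refine Finset.sum_congr rfl fun p hp => ?_
      simp [(h₁ p hp).2, Preadditive.comp_sum]
  · rfl

instance instCategoryStruct : CategoryStruct (TruncExt n B) where
  Hom X Y := Hom X Y
  id X := ⟨𝟙 X.obj⟩
  comp f g := ⟨f.hom ≫ g.hom⟩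

instance homCat (X Y : TruncExt n B) : Category (X ⟶ Y) where
  Hom f g := Hom₂ f g
  id f := const (𝟙 f.hom)
  comp σ τ := vcomp σ τ
  id_comp σ := by ext k; rw [const_vcomp, Category.id_comp]
  comp_id σ := by ext k; rw [vcomp_const, Category.comp_id]
  assoc σ τ ρ := vcomp_assoc σ τ ρ

/-- The coefficient of `h^k` in a 2-morphism of `B[h]/(h^{n+1})`. -/
def coeff {X Y : TruncExt n B} {f g : X ⟶ Y} (η : f ⟶ g) (k : ℕ) :
    Hom.hom f ⟶ Hom.hom g := Hom₂.coeff η k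

lemma hom₂_ext {X Y : TruncExt n B} {f g : X ⟶ Y} {η θ : f ⟶ g}
    (h : ∀ k, coeff η k = coeff θ k) : η = θ := Hom₂.ext (funext h)

lemma coeff_eq_zero {X Y : TruncExt n B} {f g : X ⟶ Y} (η : f ⟶ g) (k : ℕ) (hk : n < k) :
    coeff η k = 0 := Hom₂.coeff_eq_zero η k hk

/-- A 2-morphism of `B` as a constant polynomial. -/
def constHom {X Y : TruncExt n B} {f g : X ⟶ Y} (τ : Hom.hom f ⟶ Hom.hom g) : f ⟶ g :=
  const τ

lemma coeff_constHom {X Y : TruncExt n B} {f g : X ⟶ Y} (τ : Hom.hom f ⟶ Hom.hom g) (k : ℕ) :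
    coeff (constHom τ : f ⟶ g) k = if k = 0 then τ else 0 := rfl

lemma coeff_id {X Y : TruncExt n B} (f : X ⟶ Y) (k : ℕ) :
    coeff (𝟙 f) k = if k = 0 then 𝟙 (Hom.hom f) else 0 := rfl

lemma coeff_comp {X Y : TruncExt n B} {f g l : X ⟶ Y} (σ : f ⟶ g) (τ : g ⟶ l) (k : ℕ) :
    coeff (σ ≫ τ) k =
      if k ≤ n then ∑ p ∈ antidiagonal k, coeff σ p.1 ≫ coeff τ p.2 else 0 := rfl

@[simp] lemma coeff_constHom_comp {X Y : TruncExt n B} {f g l : X ⟶ Y}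
    (σ : Hom.hom f ⟶ Hom.hom g) (τ : g ⟶ l) (k : ℕ) :
    coeff ((constHom σ : f ⟶ g) ≫ τ) k = σ ≫ coeff τ k := const_vcomp σ τ k

@[simp] lemma coeff_comp_constHom {X Y : TruncExt n B} {f g l : X ⟶ Y}
    (σ : f ⟶ g) (τ : Hom.hom g ⟶ Hom.hom l) (k : ℕ) :
    coeff (σ ≫ (constHom τ : g ⟶ l)) k = coeff σ k ≫ τ := vcomp_const σ τ k

/-- An isomorphism of `B` as an isomorphism between constant polynomials. -/
@[simps]
def constIso {X Y : TruncExt n B} {f g : X ⟶ Y} (e : Hom.hom f ≅ Hom.hom g) : f ≅ g where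
  hom := constHom e.hom
  inv := constHom e.inv
  hom_inv_id := hom₂_ext fun k => by
    rw [coeff_constHom_comp, coeff_constHom, coeff_id]; split_ifs <;> simp
  inv_hom_id := hom₂_ext fun k => by
    rw [coeff_constHom_comp, coeff_constHom, coeff_id]; split_ifs <;> simp

/-- Whiskering of a polynomial with a 1-morphism, coefficientwise. -/
def whiskerL {X Y Z : TruncExt n B} (f : X ⟶ Y) {g g' : Y ⟶ Z} (η : g ⟶ g') :
    f ≫ g ⟶ f ≫ g' :=
  show Hom₂ _ _ from
  { coeff := fun k => Hom.hom f ◁ coeff η k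
    coeff_eq_zero := fun k hk => by rw [TruncExt.coeff_eq_zero η k hk]; exact whiskerLeft_zero _ _ _ }

/-- Whiskering of a polynomial with a 1-morphism, coefficientwise. -/
def whiskerR {X Y Z : TruncExt n B} {f f' : X ⟶ Y} (η : f ⟶ f') (g : Y ⟶ Z) :
    f ≫ g ⟶ f' ≫ g :=
  show Hom₂ _ _ from
  { coeff := fun k => coeff η k ▷ Hom.hom g
    coeff_eq_zero := fun k hk => by rw [TruncExt.coeff_eq_zero η k hk]; exact zero_whiskerRight _ _ _ }

@[simp] lemma coeff_whiskerL {X Y Z : TruncExt n B} (f : X ⟶ Y) {g g' : Y ⟶ Z} (η : g ⟶ g')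
    (k : ℕ) : coeff (whiskerL f η) k = Hom.hom f ◁ coeff η k := rfl

@[simp] lemma coeff_whiskerR {X Y Z : TruncExt n B} {f f' : X ⟶ Y} (η : f ⟶ f') (g : Y ⟶ Z)
    (k : ℕ) : coeff (whiskerR η g) k = coeff η k ▷ Hom.hom g := rfl

lemma constHom_comp {X Y : TruncExt n B} {f g l : X ⟶ Y} (σ : Hom.hom f ⟶ Hom.hom g)
    (τ : Hom.hom g ⟶ Hom.hom l) :
    (constHom σ : f ⟶ g) ≫ (constHom τ : g ⟶ l) = constHom (σ ≫ τ) := hom₂_ext fun k => by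
  rw [coeff_constHom_comp, coeff_constHom, coeff_constHom]; split_ifs <;> simp

lemma whiskerL_constHom {X Y Z : TruncExt n B} (f : X ⟶ Y) {g g' : Y ⟶ Z}
    (τ : Hom.hom g ⟶ Hom.hom g') :
    whiskerL f (constHom τ : g ⟶ g') = constHom (Hom.hom f ◁ τ) := hom₂_ext fun k => by
  rw [coeff_whiskerL, coeff_constHom, coeff_constHom]
  split_ifs
  · rfl
  · exact whiskerLeft_zero _ _ _

lemma whiskerR_constHom {X Y Z : TruncExt n B} {f f' : X ⟶ Y}
    (τ : Hom.hom f ⟶ Hom.hom f') (g : Y ⟶ Z) :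
    whiskerR (constHom τ : f ⟶ f') g = constHom (τ ▷ Hom.hom g) := hom₂_ext fun k => by
  rw [coeff_whiskerR, coeff_constHom, coeff_constHom]
  split_ifs
  · rfl
  · exact zero_whiskerRight _ _ _

/-- The extension `B[h]/(h^{n+1})`. The horizontal composition of 2-morphisms it induces is
the product of polynomials modulo `h^{n+1}`. -/
instance : Bicategory (TruncExt n B) where
  homCategory := homCat
  whiskerLeft f _ _ η := whiskerL f η
  whiskerRight η g := whiskerR η g
  associator f g l := constIso (α_ (Hom.hom f) (Hom.hom g) (Hom.hom l))
  leftUnitor f := constIso (λ_ (Hom.hom f))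
  rightUnitor f := constIso (ρ_ (Hom.hom f))
  whiskerLeft_id f g := hom₂_ext fun k => by
    simp only [coeff_whiskerL, coeff_id]; split_ifs
    · exact whiskerLeft_id _ _
    · exact whiskerLeft_zero _ _ _
  whiskerLeft_comp f g l m η θ := hom₂_ext fun k => by
    simp only [coeff_whiskerL, coeff_comp]; split_ifs <;> simp
  id_whiskerLeft η := hom₂_ext fun k => by
    simp only [coeff_whiskerL, constIso_hom, constIso_inv, coeff_constHom_comp,
      coeff_comp_constHom]
    exact id_whiskerLeft _
  comp_whiskerLeft f g _ _ η := hom₂_ext fun k => by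
    simp only [coeff_whiskerL, constIso_hom, constIso_inv, coeff_constHom_comp,
      coeff_comp_constHom]
    exact comp_whiskerLeft _ _ _
  id_whiskerRight f g := hom₂_ext fun k => by
    simp only [coeff_whiskerR, coeff_id]; split_ifs
    · exact id_whiskerRight _ _
    · exact zero_whiskerRight _ _ _
  comp_whiskerRight η θ f := hom₂_ext fun k => by
    simp only [coeff_whiskerR, coeff_comp]; split_ifs <;> simp
  whiskerRight_id η := hom₂_ext fun k => by
    simp only [coeff_whiskerR, constIso_hom, constIso_inv, coeff_constHom_comp,
      coeff_comp_constHom]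
    exact whiskerRight_id _
  whiskerRight_comp η f g := hom₂_ext fun k => by
    simp only [coeff_whiskerR, constIso_hom, constIso_inv, coeff_constHom_comp,
      coeff_comp_constHom]
    exact whiskerRight_comp _ _ _
  whisker_assoc f _ _ η g := hom₂_ext fun k => by
    simp only [coeff_whiskerL, coeff_whiskerR, constIso_hom, constIso_inv, coeff_constHom_comp,
      coeff_comp_constHom]
    exact whisker_assoc _ _ _
  whisker_exchange η θ := hom₂_ext fun k => by
    simp only [coeff_whiskerL, coeff_whiskerR, coeff_comp]
    split_ifs
    · rw [← Finset.Nat.sum_antidiagonal_swap]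
      exact Finset.sum_congr rfl fun p _ => whisker_exchange _ _
    · rfl
  pentagon f g l m := by
    simp only [constIso_hom, whiskerR_constHom, whiskerL_constHom]
    erw [constHom_comp, constHom_comp, constHom_comp]
    exact congrArg constHom (pentagon _ _ _ _)
  triangle f g := by
    simp only [constIso_hom, whiskerR_constHom, whiskerL_constHom]
    erw [constHom_comp]
    exact congrArg constHom (triangle _ _)

end TruncExt

/-! ### Pseudofunctorial structures and deformations -/

/-- A pseudofunctorial structure on given actions on objects, 1-morphisms and 2-morphisms: the
data and the axioms that turn `P` into a pseudofunctor. -/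
structure PseudofunctorialStructure {B : Type u₁} [Bicategory.{w₁, v₁} B] {C : Type u₂}
    [Bicategory.{w₂, v₂} C] (P : PrelaxFunctor B C) where
  mapId (X : B) : P.map (𝟙 X) ≅ 𝟙 (P.obj X)
  mapComp {X Y Z : B} (f : X ⟶ Y) (g : Y ⟶ Z) : P.map (f ≫ g) ≅ P.map f ≫ P.map g
  map₂_whisker_left {X Y Z : B} (f : X ⟶ Y) {g h : Y ⟶ Z} (η : g ⟶ h) :
    P.map₂ (f ◁ η) = (mapComp f g).hom ≫ P.map f ◁ P.map₂ η ≫ (mapComp f h).inv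
  map₂_whisker_right {X Y Z : B} {f g : X ⟶ Y} (η : f ⟶ g) (h : Y ⟶ Z) :
    P.map₂ (η ▷ h) = (mapComp f h).hom ≫ P.map₂ η ▷ P.map h ≫ (mapComp g h).inv
  map₂_associator {X Y Z T : B} (f : X ⟶ Y) (g : Y ⟶ Z) (h : Z ⟶ T) :
    P.map₂ (α_ f g h).hom = (mapComp (f ≫ g) h).hom ≫ (mapComp f g).hom ▷ P.map h ≫
      (α_ (P.map f) (P.map g) (P.map h)).hom ≫ P.map f ◁ (mapComp g h).inv ≫
      (mapComp f (g ≫ h)).inv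
  map₂_left_unitor {X Y : B} (f : X ⟶ Y) :
    P.map₂ (λ_ f).hom = (mapComp (𝟙 X) f).hom ≫ (mapId X).hom ▷ P.map f ≫ (λ_ (P.map f)).hom
  map₂_right_unitor {X Y : B} (f : X ⟶ Y) :
    P.map₂ (ρ_ f).hom = (mapComp f (𝟙 Y)).hom ≫ P.map f ◁ (mapId Y).hom ≫ (ρ_ (P.map f)).hom

/-- The pseudofunctor given by a pseudofunctorial structure. -/
def PseudofunctorialStructure.toPseudofunctor {B : Type u₁} [Bicategory.{w₁, v₁} B]
    {C : Type u₂} [Bicategory.{w₂, v₂} C] {P : PrelaxFunctor B C}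
    (S : PseudofunctorialStructure P) : Pseudofunctor B C where
  toPrelaxFunctor := P
  mapId := S.mapId
  mapComp := S.mapComp
  map₂_whisker_left := S.map₂_whisker_left
  map₂_whisker_right := S.map₂_whisker_right
  map₂_associator := S.map₂_associator
  map₂_left_unitor := S.map₂_left_unitor
  map₂_right_unitor := S.map₂_right_unitor

section Deformation

variable (K : Type uK) [Field K]
  {B : Type u₁} [Bicategory.{w₁, v₁} B] [PreadditiveBicategory B] [LinearBicategory K B]
  {C : Type u₂} [Bicategory.{w₂, v₂} C] [PreadditiveBicategory C] [LinearBicategory K C]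
  (F : Pseudofunctor B C) [LinearPseudofunctor K F]

/-- The action of `F` on 2-morphisms as an additive map. -/
def map₂Hom {X Y : B} (f g : X ⟶ Y) : (f ⟶ g) →+ (F.map f ⟶ F.map g) :=
  AddMonoidHom.mk' (fun η => F.map₂ η) (LinearPseudofunctor.map₂_add K)

/-- The extension of `F` to polynomials, `F(∑ τ_k h^k) = ∑ F(τ_k) h^k`, as an action on objects,
1-morphisms and 2-morphisms. -/
def truncMap (n : ℕ) : PrelaxFunctor (TruncExt n B) (TruncExt n C) where
  obj X := ⟨F.obj X.obj⟩
  map f := ⟨F.map (TruncExt.Hom.hom f)⟩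
  map₂ η := show TruncExt.Hom₂ _ _ from
    { coeff := fun k => F.map₂ (TruncExt.coeff η k)
      coeff_eq_zero := fun k hk => by
        rw [TruncExt.coeff_eq_zero η k hk]; exact (map₂Hom K F _ _).map_zero }
  map₂_id f := TruncExt.hom₂_ext fun k => by
    change F.map₂ (TruncExt.coeff (𝟙 f) k) = TruncExt.coeff (𝟙 _) k
    rw [TruncExt.coeff_id, TruncExt.coeff_id]
    split_ifs
    · exact F.map₂_id _
    · exact (map₂Hom K F _ _).map_zero
  map₂_comp {_ _ f _ l} η θ := TruncExt.hom₂_ext fun k => by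
    change F.map₂ (TruncExt.coeff (η ≫ θ) k) = TruncExt.coeff (_ ≫ _) k
    rw [TruncExt.coeff_comp, TruncExt.coeff_comp]
    split_ifs
    · exact (map_sum (map₂Hom K F (TruncExt.Hom.hom f) (TruncExt.Hom.hom l)) _ _).trans
        (Finset.sum_congr rfl fun p _ => F.map₂_comp _ _)
    · exact (map₂Hom K F _ _).map_zero

/-- A purely pseudofunctorial `n`-th order deformation of `F`: a pseudofunctor
`B[h]/(h^{n+1}) ⟶ C[h]/(h^{n+1})` that differs from the extension of `F` only in the
pseudofunctorial structure, which has the pseudofunctorial structure of `F` as its term of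
order zero. -/
structure NthOrderDeformation (n : ℕ) extends PseudofunctorialStructure (truncMap K F n) where
  coeff_zero_mapComp {X Y Z : TruncExt n B} (f : X ⟶ Y) (g : Y ⟶ Z) :
    TruncExt.coeff (mapComp f g).inv 0 = (F.mapComp (TruncExt.Hom.hom f) (TruncExt.Hom.hom g)).inv
  coeff_zero_mapId (X : TruncExt n B) :
    TruncExt.coeff (mapId X).hom 0 = (F.mapId X.obj).hom

end Deformation

/-! ### The deformation complex -/

section Complex

variable (K : Type uK) [Field K]
  {B : Type u₁} [Bicategory.{w₁, v₁} B]
  {C : Type u₂} [Bicategory.{w₂, v₂} C] [PreadditiveBicategory C] [LinearBicategory K C]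
  (F : Pseudofunctor B C)

/-- Families of 2-morphisms `F(g) ∘ F(f) ⟶ F(g ∘ f)`. -/
abbrev Fam₂ := ∀ ⦃X Y Z : B⦄ (f : X ⟶ Y) (g : Y ⟶ Z), F.map f ≫ F.map g ⟶ F.map (f ≫ g)

/-- Families of 2-morphisms `F(l) ∘ F(g) ∘ F(f) ⟶ F(l ∘ g ∘ f)`. -/
abbrev Fam₃ := ∀ ⦃X Y Z T : B⦄ (f : X ⟶ Y) (g : Y ⟶ Z) (l : Z ⟶ T),
  F.map f ≫ F.map g ≫ F.map l ⟶ F.map (f ≫ g ≫ l)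

/-- Families of 2-morphisms `F(m) ∘ F(l) ∘ F(g) ∘ F(f) ⟶ F(m ∘ l ∘ g ∘ f)`. -/
abbrev Fam₄ := ∀ ⦃X Y Z T U : B⦄ (f : X ⟶ Y) (g : Y ⟶ Z) (l : Z ⟶ T) (m : T ⟶ U),
  F.map f ≫ F.map g ≫ F.map l ≫ F.map m ⟶ F.map (f ≫ g ≫ l ≫ m)

variable {F}

/-- Naturality in each variable. -/
structure IsNat₂ (φ : Fam₂ F) : Prop where
  nat₁ {X Y Z : B} {f f' : X ⟶ Y} (η : f ⟶ f') (g : Y ⟶ Z) :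
    F.map₂ η ▷ F.map g ≫ φ f' g = φ f g ≫ F.map₂ (η ▷ g)
  nat₂ {X Y Z : B} (f : X ⟶ Y) {g g' : Y ⟶ Z} (η : g ⟶ g') :
    F.map f ◁ F.map₂ η ≫ φ f g' = φ f g ≫ F.map₂ (f ◁ η)

/-- Naturality in each variable. -/
structure IsNat₃ (φ : Fam₃ F) : Prop where
  nat₁ {X Y Z T : B} {f f' : X ⟶ Y} (η : f ⟶ f') (g : Y ⟶ Z) (l : Z ⟶ T) :
    F.map₂ η ▷ (F.map g ≫ F.map l) ≫ φ f' g l = φ f g l ≫ F.map₂ (η ▷ (g ≫ l))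
  nat₂ {X Y Z T : B} (f : X ⟶ Y) {g g' : Y ⟶ Z} (η : g ⟶ g') (l : Z ⟶ T) :
    F.map f ◁ F.map₂ η ▷ F.map l ≫ φ f g' l = φ f g l ≫ F.map₂ (f ◁ η ▷ l)
  nat₃ {X Y Z T : B} (f : X ⟶ Y) (g : Y ⟶ Z) {l l' : Z ⟶ T} (η : l ⟶ l') :
    F.map f ◁ F.map g ◁ F.map₂ η ≫ φ f g l' = φ f g l ≫ F.map₂ (f ◁ g ◁ η)

/-- Naturality in each variable. -/
structure IsNat₄ (φ : Fam₄ F) : Prop where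
  nat₁ {X Y Z T U : B} {f f' : X ⟶ Y} (η : f ⟶ f') (g : Y ⟶ Z) (l : Z ⟶ T) (m : T ⟶ U) :
    F.map₂ η ▷ (F.map g ≫ F.map l ≫ F.map m) ≫ φ f' g l m =
      φ f g l m ≫ F.map₂ (η ▷ (g ≫ l ≫ m))
  nat₂ {X Y Z T U : B} (f : X ⟶ Y) {g g' : Y ⟶ Z} (η : g ⟶ g') (l : Z ⟶ T) (m : T ⟶ U) :
    F.map f ◁ F.map₂ η ▷ (F.map l ≫ F.map m) ≫ φ f g' l m =
      φ f g l m ≫ F.map₂ (f ◁ η ▷ (l ≫ m))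
  nat₃ {X Y Z T U : B} (f : X ⟶ Y) (g : Y ⟶ Z) {l l' : Z ⟶ T} (η : l ⟶ l') (m : T ⟶ U) :
    F.map f ◁ F.map g ◁ F.map₂ η ▷ F.map m ≫ φ f g l' m =
      φ f g l m ≫ F.map₂ (f ◁ g ◁ η ▷ m)
  nat₄ {X Y Z T U : B} (f : X ⟶ Y) (g : Y ⟶ Z) (l : Z ⟶ T) {m m' : T ⟶ U} (η : m ⟶ m') :
    F.map f ◁ F.map g ◁ F.map l ◁ F.map₂ η ≫ φ f g l m' =
      φ f g l m ≫ F.map₂ (f ◁ g ◁ l ◁ η)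

attribute [simp] IsNat₂.nat₁ IsNat₂.nat₂ IsNat₃.nat₁ IsNat₃.nat₂ IsNat₃.nat₃

variable (F)

/-- `X²(F)`: natural transformations `F^{(1,1)} ⟶ F^{(2)}`, one for each triple of
objects. -/
@[ext]
structure X₂ where
  fam : Fam₂ F
  isNat : IsNat₂ fam

namespace X₂

variable {F}

instance : Zero (X₂ F) where
  zero := ⟨0, by constructor <;> intros <;> simp⟩

instance : Add (X₂ F) where
  add φ ψ := ⟨φ.fam + ψ.fam, by
    constructor <;> intros <;>
      simp only [Pi.add_apply, Preadditive.comp_add, Preadditive.add_comp, φ.isNat.nat₁, ψ.isNat.nat₁, φ.isNat.nat₂, ψ.isNat.nat₂]⟩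

instance : Neg (X₂ F) where
  neg φ := ⟨-φ.fam, by
    constructor <;> intros <;>
      simp only [Pi.neg_apply, Preadditive.comp_neg, Preadditive.neg_comp, φ.isNat.nat₁, φ.isNat.nat₂]⟩

instance : SMul K (X₂ F) where
  smul r φ := ⟨r • φ.fam, by
    constructor <;> intros <;>
      simp only [Pi.smul_apply, Linear.comp_smul, Linear.smul_comp, φ.isNat.nat₁, φ.isNat.nat₂]⟩

@[simp] lemma fam_zero : (0 : X₂ F).fam = 0 := rfl
@[simp] lemma fam_add (φ ψ : X₂ F) : (φ + ψ).fam = φ.fam + ψ.fam := rfl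
@[simp] lemma fam_neg (φ : X₂ F) : (-φ).fam = -φ.fam := rfl
@[simp] lemma fam_smul (r : K) (φ : X₂ F) : (r • φ).fam = r • φ.fam := rfl

instance : AddCommGroup (X₂ F) where
  add_assoc φ ψ χ := X₂.ext (add_assoc φ.fam ψ.fam χ.fam)
  zero_add φ := X₂.ext (zero_add φ.fam)
  add_zero φ := X₂.ext (add_zero φ.fam)
  neg_add_cancel φ := X₂.ext (neg_add_cancel φ.fam)
  add_comm φ ψ := X₂.ext (add_comm φ.fam ψ.fam)
  nsmul := nsmulRec
  zsmul := zsmulRec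

instance : Module K (X₂ F) where
  one_smul φ := X₂.ext (one_smul K φ.fam)
  mul_smul r t φ := X₂.ext (mul_smul r t φ.fam)
  smul_zero r := X₂.ext (smul_zero r)
  smul_add r φ ψ := X₂.ext (smul_add r φ.fam ψ.fam)
  add_smul r t φ := X₂.ext (add_smul r t φ.fam)
  zero_smul φ := X₂.ext (zero_smul K φ.fam)

end X₂

/-- `X³(F)`: natural transformations `F^{(1,1,1)} ⟶ F^{(3)}`, one for each quadruple of
objects. -/
@[ext]
structure X₃ where
  fam : Fam₃ F
  isNat : IsNat₃ fam

namespace X₃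

variable {F}

instance : Zero (X₃ F) where
  zero := ⟨0, by constructor <;> intros <;> simp⟩

instance : Add (X₃ F) where
  add φ ψ := ⟨φ.fam + ψ.fam, by
    constructor <;> intros <;>
      simp only [Pi.add_apply, Preadditive.comp_add, Preadditive.add_comp, φ.isNat.nat₁, ψ.isNat.nat₁, φ.isNat.nat₂, ψ.isNat.nat₂, φ.isNat.nat₃, ψ.isNat.nat₃]⟩

instance : Neg (X₃ F) where
  neg φ := ⟨-φ.fam, by
    constructor <;> intros <;>
      simp only [Pi.neg_apply, Preadditive.comp_neg, Preadditive.neg_comp, φ.isNat.nat₁, φ.isNat.nat₂, φ.isNat.nat₃]⟩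

instance : SMul K (X₃ F) where
  smul r φ := ⟨r • φ.fam, by
    constructor <;> intros <;>
      simp only [Pi.smul_apply, Linear.comp_smul, Linear.smul_comp, φ.isNat.nat₁, φ.isNat.nat₂, φ.isNat.nat₃]⟩

@[simp] lemma fam_zero : (0 : X₃ F).fam = 0 := rfl
@[simp] lemma fam_add (φ ψ : X₃ F) : (φ + ψ).fam = φ.fam + ψ.fam := rfl
@[simp] lemma fam_neg (φ : X₃ F) : (-φ).fam = -φ.fam := rfl
@[simp] lemma fam_smul (r : K) (φ : X₃ F) : (r • φ).fam = r • φ.fam := rfl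

instance : AddCommGroup (X₃ F) where
  add_assoc φ ψ χ := X₃.ext (add_assoc φ.fam ψ.fam χ.fam)
  zero_add φ := X₃.ext (zero_add φ.fam)
  add_zero φ := X₃.ext (add_zero φ.fam)
  neg_add_cancel φ := X₃.ext (neg_add_cancel φ.fam)
  add_comm φ ψ := X₃.ext (add_comm φ.fam ψ.fam)
  nsmul := nsmulRec
  zsmul := zsmulRec

instance : Module K (X₃ F) where
  one_smul φ := X₃.ext (one_smul K φ.fam)
  mul_smul r t φ := X₃.ext (mul_smul r t φ.fam)
  smul_zero r := X₃.ext (smul_zero r)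
  smul_add r φ ψ := X₃.ext (smul_add r φ.fam ψ.fam)
  add_smul r t φ := X₃.ext (add_smul r t φ.fam)
  zero_smul φ := X₃.ext (zero_smul K φ.fam)

end X₃

/-- `X⁴(F)`: natural transformations `F^{(1,1,1,1)} ⟶ F^{(4)}`, one for each quintuple of
objects. -/
@[ext]
structure X₄ where
  fam : Fam₄ F
  isNat : IsNat₄ fam

namespace X₄

variable {F}

instance : Zero (X₄ F) where
  zero := ⟨0, by constructor <;> intros <;> simp⟩

instance : Add (X₄ F) where
  add φ ψ := ⟨φ.fam + ψ.fam, by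
    constructor <;> intros <;>
      simp only [Pi.add_apply, Preadditive.comp_add, Preadditive.add_comp, φ.isNat.nat₁, ψ.isNat.nat₁, φ.isNat.nat₂, ψ.isNat.nat₂, φ.isNat.nat₃, ψ.isNat.nat₃, φ.isNat.nat₄, ψ.isNat.nat₄]⟩

instance : Neg (X₄ F) where
  neg φ := ⟨-φ.fam, by
    constructor <;> intros <;>
      simp only [Pi.neg_apply, Preadditive.comp_neg, Preadditive.neg_comp, φ.isNat.nat₁, φ.isNat.nat₂, φ.isNat.nat₃, φ.isNat.nat₄]⟩

instance : SMul K (X₄ F) where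
  smul r φ := ⟨r • φ.fam, by
    constructor <;> intros <;>
      simp only [Pi.smul_apply, Linear.comp_smul, Linear.smul_comp, φ.isNat.nat₁, φ.isNat.nat₂, φ.isNat.nat₃, φ.isNat.nat₄]⟩

@[simp] lemma fam_zero : (0 : X₄ F).fam = 0 := rfl
@[simp] lemma fam_add (φ ψ : X₄ F) : (φ + ψ).fam = φ.fam + ψ.fam := rfl
@[simp] lemma fam_neg (φ : X₄ F) : (-φ).fam = -φ.fam := rfl
@[simp] lemma fam_smul (r : K) (φ : X₄ F) : (r • φ).fam = r • φ.fam := rfl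

instance : AddCommGroup (X₄ F) where
  add_assoc φ ψ χ := X₄.ext (add_assoc φ.fam ψ.fam χ.fam)
  zero_add φ := X₄.ext (zero_add φ.fam)
  add_zero φ := X₄.ext (add_zero φ.fam)
  neg_add_cancel φ := X₄.ext (neg_add_cancel φ.fam)
  add_comm φ ψ := X₄.ext (add_comm φ.fam ψ.fam)
  nsmul := nsmulRec
  zsmul := zsmulRec

instance : Module K (X₄ F) where
  one_smul φ := X₄.ext (one_smul K φ.fam)
  mul_smul r t φ := X₄.ext (mul_smul r t φ.fam)
  smul_zero r := X₄.ext (smul_zero r)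
  smul_add r φ ψ := X₄.ext (smul_add r φ.fam ψ.fam)
  add_smul r t φ := X₄.ext (add_smul r t φ.fam)
  zero_smul φ := X₄.ext (zero_smul K φ.fam)

end X₄

/-- The family `F̂(f, g) : F(g) ∘ F(f) ⟶ F(g ∘ f)` of the pseudofunctor `F`. -/
def hat : Fam₂ F := fun _ _ _ f g => (F.mapComp f g).inv

lemma isNat_hat : IsNat₂ (hat F) where
  nat₁ η g := by simp [hat]
  nat₂ f _ _ η := by simp [hat]

variable {F}

/-- The composite `φ(g ∘ f, l) · (1_{F(l)} ∘ ψ(f, g))`. -/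
def compL (φ ψ : Fam₂ F) : Fam₃ F := fun _ _ _ _ f g l =>
  (α_ (F.map f) (F.map g) (F.map l)).inv ≫ ψ f g ▷ F.map l ≫ φ (f ≫ g) l ≫
    F.map₂ (α_ f g l).hom

/-- The composite `φ(f, l ∘ g) · (ψ(g, l) ∘ 1_{F(f)})`. -/
def compR (φ ψ : Fam₂ F) : Fam₃ F := fun _ _ _ _ f g l =>
  F.map f ◁ ψ g l ≫ φ f (g ≫ l)

lemma IsNat₂.compL {φ ψ : Fam₂ F} (hφ : IsNat₂ φ) (hψ : IsNat₂ ψ) :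
    IsNat₃ (compL φ ψ) where
  nat₁ η g l := by
    simp only [PseudoDeformation.compL, Category.assoc, whiskerRight_comp, Iso.hom_inv_id_assoc]
    rw [← comp_whiskerRight_assoc, hψ.nat₁, comp_whiskerRight_assoc, ← Category.assoc (F.map₂ _ ▷ _),
      hφ.nat₁, Category.assoc, ← F.map₂_comp, ← F.map₂_comp]
    simp only [Category.assoc, Iso.inv_hom_id, Category.comp_id, Iso.hom_inv_id_assoc]
  nat₂ f _ _ η l := by
    simp only [PseudoDeformation.compL, Category.assoc, associator_inv_naturality_middle_assoc]
    rw [← comp_whiskerRight_assoc, hψ.nat₂, comp_whiskerRight_assoc, ← Category.assoc (F.map₂ _ ▷ _),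
      hφ.nat₁, Category.assoc, ← F.map₂_comp, ← F.map₂_comp, associator_naturality_middle]
  nat₃ f g _ _ η := by
    simp only [PseudoDeformation.compL, Category.assoc, associator_inv_naturality_right_assoc]
    rw [whisker_exchange_assoc, ← Category.assoc (_ ◁ _) (φ _ _),
      hφ.nat₂, Category.assoc, ← F.map₂_comp, ← F.map₂_comp, associator_naturality_right]

lemma IsNat₂.compR {φ ψ : Fam₂ F} (hφ : IsNat₂ φ) (hψ : IsNat₂ ψ) :
    IsNat₃ (compR φ ψ) where
  nat₁ η g l := by
    simp only [PseudoDeformation.compR, Category.assoc]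
    rw [← whisker_exchange_assoc, hφ.nat₁]
  nat₂ f _ _ η l := by
    simp only [PseudoDeformation.compR, Category.assoc]
    rw [← whiskerLeft_comp_assoc, hψ.nat₁, whiskerLeft_comp_assoc, hφ.nat₂]
  nat₃ f g _ _ η := by
    simp only [PseudoDeformation.compR, Category.assoc]
    rw [← whiskerLeft_comp_assoc, hψ.nat₂, whiskerLeft_comp_assoc, hφ.nat₂]

/-- The padded first coface `φ(g, l, m) ∘ 1_{F(f)}`. -/
def coface₀ (φ : Fam₃ F) : Fam₄ F := fun _ _ _ _ _ f g l m =>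
  F.map f ◁ φ g l m ≫ hat F f (g ≫ l ≫ m)

/-- The padded coface `φ(g ∘ f, l, m)`. -/
def coface₁ (φ : Fam₃ F) : Fam₄ F := fun _ _ _ _ _ f g l m =>
  (α_ (F.map f) (F.map g) (F.map l ≫ F.map m)).inv ≫ hat F f g ▷ (F.map l ≫ F.map m) ≫
    φ (f ≫ g) l m ≫ F.map₂ (α_ f g (l ≫ m)).hom

/-- The padded coface `φ(f, l ∘ g, m)`. -/
def coface₂ (φ : Fam₃ F) : Fam₄ F := fun _ _ _ _ _ f g l m =>
  F.map f ◁ ((α_ (F.map g) (F.map l) (F.map m)).inv ≫ hat F g l ▷ F.map m) ≫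
    φ f (g ≫ l) m ≫ F.map₂ (f ◁ (α_ g l m).hom)

/-- The padded coface `φ(f, g, m ∘ l)`. -/
def coface₃ (φ : Fam₃ F) : Fam₄ F := fun _ _ _ _ _ f g l m =>
  F.map f ◁ F.map g ◁ hat F l m ≫ φ f g (l ≫ m)

/-- The padded last coface `1_{F(m)} ∘ φ(f, g, l)`. -/
def coface₄ (φ : Fam₃ F) : Fam₄ F := fun _ _ _ _ _ f g l m =>
  F.map f ◁ (α_ (F.map g) (F.map l) (F.map m)).inv ≫
    (α_ (F.map f) (F.map g ≫ F.map l) (F.map m)).inv ≫ φ f g l ▷ F.map m ≫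
    hat F (f ≫ g ≫ l) m ≫ F.map₂ ((α_ f (g ≫ l) m).hom ≫ f ◁ (α_ g l m).hom)

lemma isNat_coface₀ {φ : Fam₃ F} (hφ : IsNat₃ φ) : IsNat₄ (coface₀ φ) where
  nat₁ η g l m := by
    simp only [coface₀, Category.assoc]
    rw [← whisker_exchange_assoc, (isNat_hat F).nat₁]
  nat₂ f _ _ η l m := by
    simp only [coface₀, Category.assoc]
    rw [← whiskerLeft_comp_assoc, hφ.nat₁, whiskerLeft_comp_assoc, (isNat_hat F).nat₂]
  nat₃ f g _ _ η m := by
    simp only [coface₀, Category.assoc]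
    rw [← whiskerLeft_comp_assoc, hφ.nat₂, whiskerLeft_comp_assoc, (isNat_hat F).nat₂]
  nat₄ f g l _ _ η := by
    simp only [coface₀, Category.assoc]
    rw [← whiskerLeft_comp_assoc, hφ.nat₃, whiskerLeft_comp_assoc, (isNat_hat F).nat₂]

lemma isNat_coface₁ {φ : Fam₃ F} (hφ : IsNat₃ φ) : IsNat₄ (coface₁ φ) where
  nat₁ η g l m := by
    simp only [coface₁, Category.assoc]
    rw [associator_inv_naturality_left_assoc, ← comp_whiskerRight_assoc, (isNat_hat F).nat₁,
      comp_whiskerRight_assoc, ← Category.assoc (F.map₂ _ ▷ _), hφ.nat₁, Category.assoc,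
      ← F.map₂_comp, ← F.map₂_comp, associator_naturality_left]
  nat₂ f _ _ η l m := by
    simp only [coface₁, Category.assoc]
    rw [associator_inv_naturality_middle_assoc, ← comp_whiskerRight_assoc, (isNat_hat F).nat₂,
      comp_whiskerRight_assoc, ← Category.assoc (F.map₂ _ ▷ _), hφ.nat₁, Category.assoc,
      ← F.map₂_comp, ← F.map₂_comp, associator_naturality_middle]
  nat₃ f g _ _ η m := by
    simp only [coface₁, Category.assoc]
    rw [associator_inv_naturality_right_assoc, whisker_exchange_assoc,
      ← Category.assoc (_ ◁ _) (φ _ _ _), hφ.nat₂, Category.assoc,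
      ← F.map₂_comp, ← F.map₂_comp, associator_naturality_right]
  nat₄ f g l _ _ η := by
    simp only [coface₁, Category.assoc]
    rw [associator_inv_naturality_right_assoc, whisker_exchange_assoc,
      ← Category.assoc (_ ◁ _) (φ _ _ _), hφ.nat₃, Category.assoc,
      ← F.map₂_comp, ← F.map₂_comp, associator_naturality_right]

lemma isNat_coface₂ {φ : Fam₃ F} (hφ : IsNat₃ φ) : IsNat₄ (coface₂ φ) where
  nat₁ η g l m := by
    simp only [coface₂, Category.assoc]
    rw [← whisker_exchange_assoc, ← Category.assoc (F.map₂ _ ▷ _), hφ.nat₁, Category.assoc,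
      ← F.map₂_comp, ← F.map₂_comp, whisker_exchange]
  nat₂ f _ _ η l m := by
    simp only [coface₂, Category.assoc]
    rw [← whiskerLeft_comp_assoc, associator_inv_naturality_left_assoc, ← comp_whiskerRight,
      (isNat_hat F).nat₁, comp_whiskerRight, ← Category.assoc (α_ _ _ _).inv,
      whiskerLeft_comp_assoc, ← Category.assoc (_ ◁ _ ▷ _), hφ.nat₂, Category.assoc,
      ← F.map₂_comp, ← F.map₂_comp, ← whiskerLeft_comp, ← whiskerLeft_comp,
      associator_naturality_left]
  nat₃ f g _ _ η m := by
    simp only [coface₂, Category.assoc]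
    rw [← whiskerLeft_comp_assoc, associator_inv_naturality_middle_assoc, ← comp_whiskerRight,
      (isNat_hat F).nat₂, comp_whiskerRight, ← Category.assoc (α_ _ _ _).inv,
      whiskerLeft_comp_assoc, ← Category.assoc (_ ◁ _ ▷ _), hφ.nat₂, Category.assoc,
      ← F.map₂_comp, ← F.map₂_comp, ← whiskerLeft_comp, ← whiskerLeft_comp,
      associator_naturality_middle]
  nat₄ f g l _ _ η := by
    simp only [coface₂, Category.assoc]
    rw [← whiskerLeft_comp_assoc, associator_inv_naturality_right_assoc, whisker_exchange,
      ← Category.assoc (α_ _ _ _).inv,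
      whiskerLeft_comp_assoc, ← Category.assoc (_ ◁ _ ◁ _), hφ.nat₃, Category.assoc,
      ← F.map₂_comp, ← F.map₂_comp, ← whiskerLeft_comp, ← whiskerLeft_comp,
      associator_naturality_right]

lemma isNat_coface₃ {φ : Fam₃ F} (hφ : IsNat₃ φ) : IsNat₄ (coface₃ φ) where
  nat₁ η g l m := by
    simp only [coface₃, Category.assoc]
    rw [← whisker_exchange_assoc, hφ.nat₁]
  nat₂ f _ _ η l m := by
    simp only [coface₃, Category.assoc]
    rw [← whiskerLeft_comp_assoc, ← whisker_exchange, whiskerLeft_comp_assoc, hφ.nat₂]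
  nat₃ f g _ _ η m := by
    simp only [coface₃, Category.assoc]
    rw [← whiskerLeft_comp_assoc, ← whiskerLeft_comp, (isNat_hat F).nat₁, whiskerLeft_comp,
      whiskerLeft_comp_assoc, hφ.nat₃]
  nat₄ f g l _ _ η := by
    simp only [coface₃, Category.assoc]
    rw [← whiskerLeft_comp_assoc, ← whiskerLeft_comp, (isNat_hat F).nat₂, whiskerLeft_comp,
      whiskerLeft_comp_assoc, hφ.nat₃]

lemma isNat_coface₄ {φ : Fam₃ F} (hφ : IsNat₃ φ) : IsNat₄ (coface₄ φ) where
  nat₁ η g l m := by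
    simp only [coface₄, Category.assoc]
    rw [← whisker_exchange_assoc, associator_inv_naturality_left_assoc,
      ← comp_whiskerRight_assoc, hφ.nat₁, comp_whiskerRight_assoc,
      ← Category.assoc (F.map₂ _ ▷ _), (isNat_hat F).nat₁, Category.assoc,
      ← F.map₂_comp, ← F.map₂_comp, Category.assoc, associator_naturality_left_assoc,
      whisker_exchange]
  nat₂ f _ _ η l m := by
    simp only [coface₄, Category.assoc]
    rw [← whiskerLeft_comp_assoc, associator_inv_naturality_left, whiskerLeft_comp_assoc,
      associator_inv_naturality_middle_assoc,
      ← comp_whiskerRight_assoc, hφ.nat₂, comp_whiskerRight_assoc,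
      ← Category.assoc (F.map₂ _ ▷ _), (isNat_hat F).nat₁, Category.assoc,
      ← F.map₂_comp, ← F.map₂_comp, Category.assoc, associator_naturality_middle_assoc,
      ← whiskerLeft_comp, ← whiskerLeft_comp, associator_naturality_left]
  nat₃ f g _ _ η m := by
    simp only [coface₄, Category.assoc]
    rw [← whiskerLeft_comp_assoc, associator_inv_naturality_middle, whiskerLeft_comp_assoc,
      associator_inv_naturality_middle_assoc,
      ← comp_whiskerRight_assoc, hφ.nat₃, comp_whiskerRight_assoc,
      ← Category.assoc (F.map₂ _ ▷ _), (isNat_hat F).nat₁, Category.assoc,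
      ← F.map₂_comp, ← F.map₂_comp, Category.assoc, associator_naturality_middle_assoc,
      ← whiskerLeft_comp, ← whiskerLeft_comp, associator_naturality_middle]
  nat₄ f g l _ _ η := by
    simp only [coface₄, Category.assoc]
    rw [← whiskerLeft_comp_assoc, associator_inv_naturality_right, whiskerLeft_comp_assoc,
      associator_inv_naturality_right_assoc, whisker_exchange_assoc,
      ← Category.assoc (_ ◁ _) (hat F _ _), (isNat_hat F).nat₂, Category.assoc,
      ← F.map₂_comp, ← F.map₂_comp, Category.assoc, associator_naturality_right_assoc,
      ← whiskerLeft_comp, ← whiskerLeft_comp, associator_naturality_right]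

lemma IsNat₃.alt {a b c d : Fam₃ F} (ha : IsNat₃ a) (hb : IsNat₃ b) (hc : IsNat₃ c)
    (hd : IsNat₃ d) : IsNat₃ (a - b + c - d) := by
  constructor <;> intros <;>
    simp only [Pi.add_apply, Pi.sub_apply, Preadditive.comp_add, Preadditive.add_comp,
      Preadditive.comp_sub, Preadditive.sub_comp, ha.nat₁, hb.nat₁, hc.nat₁, hd.nat₁,
      ha.nat₂, hb.nat₂, hc.nat₂, hd.nat₂, ha.nat₃, hb.nat₃, hc.nat₃, hd.nat₃]

lemma IsNat₄.alt {a b c d e : Fam₄ F} (ha : IsNat₄ a) (hb : IsNat₄ b) (hc : IsNat₄ c)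
    (hd : IsNat₄ d) (he : IsNat₄ e) : IsNat₄ (a - b + c - d + e) := by
  constructor <;> intros <;>
    simp only [Pi.add_apply, Pi.sub_apply, Preadditive.comp_add, Preadditive.add_comp,
      Preadditive.comp_sub, Preadditive.sub_comp, ha.nat₁, hb.nat₁, hc.nat₁, hd.nat₁, he.nat₁,
      ha.nat₂, hb.nat₂, hc.nat₂, hd.nat₂, he.nat₂, ha.nat₃, hb.nat₃, hc.nat₃, hd.nat₃, he.nat₃,
      ha.nat₄, hb.nat₄, hc.nat₄, hd.nat₄, he.nat₄]

variable (F)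

/-- The coboundary `δ : X²(F) ⟶ X³(F)`,
`δφ(f, g, l) = ⌈φ(g, l) ∘ 1_{F(f)}⌉ - ⌈φ(g ∘ f, l)⌉ + ⌈φ(f, l ∘ g)⌉ - ⌈1_{F(l)} ∘ φ(f, g)⌉`,
where the padding `⌈-⌉` composes with the 2-morphisms `F̂` so as to obtain a 2-morphism
`F(l) ∘ F(g) ∘ F(f) ⟶ F(l ∘ g ∘ f)`. -/
def d₂ : X₂ F →ₗ[K] X₃ F where
  toFun φ := ⟨compR (hat F) φ.fam - compL φ.fam (hat F) + compR φ.fam (hat F) -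
      compL (hat F) φ.fam,
    ((isNat_hat F).compR φ.isNat).alt (φ.isNat.compL (isNat_hat F))
      (φ.isNat.compR (isNat_hat F)) ((isNat_hat F).compL φ.isNat)⟩
  map_add' φ ψ := by
    ext X Y Z T f g l
    simp [compL, compR]
    abel
  map_smul' r φ := by
    ext X Y Z T f g l
    simp [compL, compR, smul_sub, smul_add]

/-- The coboundary `δ : X³(F) ⟶ X⁴(F)`,
`δφ(f, g, l, m) = ⌈φ(g, l, m) ∘ 1_{F(f)}⌉ - ⌈φ(g ∘ f, l, m)⌉ + ⌈φ(f, l ∘ g, m)⌉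
- ⌈φ(f, g, m ∘ l)⌉ + ⌈1_{F(m)} ∘ φ(f, g, l)⌉`. -/
def d₃ : X₃ F →ₗ[K] X₄ F where
  toFun φ := ⟨coface₀ φ.fam - coface₁ φ.fam + coface₂ φ.fam - coface₃ φ.fam + coface₄ φ.fam,
    (isNat_coface₀ φ.isNat).alt (isNat_coface₁ φ.isNat) (isNat_coface₂ φ.isNat)
      (isNat_coface₃ φ.isNat) (isNat_coface₄ φ.isNat)⟩
  map_add' φ ψ := by
    ext X Y Z T U f g l m
    simp [coface₀, coface₁, coface₂, coface₃, coface₄, -Pseudofunctor.map₂_associator,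
      -Pseudofunctor.map₂_whisker_left]
    abel
  map_smul' r φ := by
    ext X Y Z T U f g l m
    simp [coface₀, coface₁, coface₂, coface₃, coface₄, smul_sub, smul_add,
      -Pseudofunctor.map₂_associator, -Pseudofunctor.map₂_whisker_left]

variable {F}

lemma hexagon {X Y Z T : B} (f : X ⟶ Y) (g : Y ⟶ Z) (l : Z ⟶ T) :
    F.map f ◁ hat F g l ≫ hat F f (g ≫ l) =
      (α_ (F.map f) (F.map g) (F.map l)).inv ≫ hat F f g ▷ F.map l ≫ hat F (f ≫ g) l ≫
        F.map₂ (α_ f g l).hom := F.mapComp_assoc_right_inv f g l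

lemma hexagon_assoc {X Y Z T : B} (f : X ⟶ Y) (g : Y ⟶ Z) (l : Z ⟶ T)
    {t : F.obj X ⟶ F.obj T} (θ : F.map (f ≫ g ≫ l) ⟶ t) :
    F.map f ◁ hat F g l ≫ hat F f (g ≫ l) ≫ θ =
      (α_ (F.map f) (F.map g) (F.map l)).inv ≫ hat F f g ▷ F.map l ≫ hat F (f ≫ g) l ≫
        F.map₂ (α_ f g l).hom ≫ θ := by
  rw [← Category.assoc, hexagon]; simp only [Category.assoc]

lemma IsNat₂.nat₁_assoc {φ : Fam₂ F} (hφ : IsNat₂ φ) {X Y Z : B} {f f' : X ⟶ Y} (η : f ⟶ f')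
    (g : Y ⟶ Z) {t : F.obj X ⟶ F.obj Z} (θ : F.map (f' ≫ g) ⟶ t) :
    F.map₂ η ▷ F.map g ≫ φ f' g ≫ θ = φ f g ≫ F.map₂ (η ▷ g) ≫ θ := by
  rw [← Category.assoc, hφ.nat₁, Category.assoc]

lemma IsNat₂.nat₂_assoc {φ : Fam₂ F} (hφ : IsNat₂ φ) {X Y Z : B} (f : X ⟶ Y) {g g' : Y ⟶ Z}
    (η : g ⟶ g') {t : F.obj X ⟶ F.obj Z} (θ : F.map (f ≫ g') ⟶ t) :
    F.map f ◁ F.map₂ η ≫ φ f g' ≫ θ = φ f g ≫ F.map₂ (f ◁ η) ≫ θ := by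
  rw [← Category.assoc, hφ.nat₂, Category.assoc]

lemma coface₁_compR_hat (φ : Fam₂ F) :
    coface₁ (compR (hat F) φ) = coface₀ (compR (hat F) φ) := by
  funext X Y Z T U f g l m
  simp only [coface₁, coface₀, compR, Category.assoc, whiskerLeft_comp]
  rw [hexagon, ← whisker_exchange_assoc, ← associator_inv_naturality_right_assoc]

lemma coface₂_compR_hat (φ : Fam₂ F) :
    coface₂ (compR (hat F) φ) = coface₀ (compL φ (hat F)) := by
  funext X Y Z T U f g l m
  simp only [coface₂, coface₀, compR, compL, Category.assoc, whiskerLeft_comp]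
  rw [(isNat_hat F).nat₂]

lemma coface₃_compR_hat (φ : Fam₂ F) :
    coface₃ (compR (hat F) φ) = coface₀ (compR φ (hat F)) := by
  funext X Y Z T U f g l m
  simp only [coface₃, coface₀, compR, Category.assoc, whiskerLeft_comp]

lemma coface₄_compR_hat (φ : Fam₂ F) :
    coface₄ (compR (hat F) φ) = coface₀ (compL (hat F) φ) := by
  funext X Y Z T U f g l m
  simp only [coface₄, coface₀, compR, compL, Category.assoc, whiskerLeft_comp, comp_whiskerRight,
    F.map₂_comp]
  rw [(isNat_hat F).nat₂, hexagon_assoc]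
  simp only [whisker_assoc, Category.assoc, Iso.inv_hom_id_assoc]

lemma coface₂_compL_hat {φ : Fam₂ F} (hφ : IsNat₂ φ) :
    coface₂ (compL φ (hat F)) = coface₁ (compL φ (hat F)) := by
  funext X Y Z T U f g l m
  simp only [coface₂, coface₁, compL, Category.assoc, whiskerLeft_comp]
  rw [associator_inv_naturality_middle_assoc, ← comp_whiskerRight_assoc, hexagon]
  simp only [comp_whiskerRight, Category.assoc]
  rw [hφ.nat₁_assoc, ← F.map₂_comp, ← F.map₂_comp, ← F.map₂_comp, pentagon]
  simp only [whiskerRight_comp, Category.assoc, Iso.hom_inv_id_assoc, pentagon_inv_assoc]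

lemma coface₃_compL_hat (φ : Fam₂ F) :
    coface₃ (compL φ (hat F)) = coface₁ (compR φ (hat F)) := by
  funext X Y Z T U f g l m
  simp only [coface₃, coface₁, compL, compR, Category.assoc]
  rw [associator_inv_naturality_right_assoc, whisker_exchange_assoc]

lemma coface₄_compL_hat (φ : Fam₂ F) :
    coface₄ (compL φ (hat F)) = coface₁ (compL (hat F) φ) := by
  funext X Y Z T U f g l m
  simp only [coface₄, coface₁, compL, Category.assoc, comp_whiskerRight]
  rw [(isNat_hat F).nat₁_assoc, ← F.map₂_comp, ← F.map₂_comp, pentagon]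
  simp only [whiskerRight_comp, Category.assoc, Iso.hom_inv_id_assoc, pentagon_inv_assoc]

lemma coface₃_compR_hat' {φ : Fam₂ F} (hφ : IsNat₂ φ) :
    coface₃ (compR φ (hat F)) = coface₂ (compR φ (hat F)) := by
  funext X Y Z T U f g l m
  simp only [coface₃, coface₂, compR, Category.assoc]
  rw [← whiskerLeft_comp_assoc, hexagon]
  simp only [whiskerLeft_comp, Category.assoc]
  rw [hφ.nat₂]

lemma coface₄_compR_hat' (φ : Fam₂ F) :
    coface₄ (compR φ (hat F)) = coface₂ (compL (hat F) φ) := by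
  funext X Y Z T U f g l m
  simp only [coface₄, coface₂, compR, compL, Category.assoc, whiskerLeft_comp, comp_whiskerRight,
    F.map₂_comp]
  rw [associator_inv_naturality_middle_assoc]

lemma coface₄_compL_hat' (φ : Fam₂ F) :
    coface₄ (compL (hat F) φ) = coface₃ (compL (hat F) φ) := by
  funext X Y Z T U f g l m
  simp only [coface₄, coface₃, compL, Category.assoc, comp_whiskerRight]
  rw [(isNat_hat F).nat₁_assoc, associator_inv_naturality_right_assoc, whisker_exchange_assoc,
    hexagon_assoc, ← F.map₂_comp, ← F.map₂_comp, pentagon]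
  simp only [whiskerRight_comp, Category.assoc, Iso.hom_inv_id_assoc, pentagon_inv_assoc]

lemma coface₀_alt (a b c d : Fam₃ F) : coface₀ (a - b + c - d) =
    coface₀ a - coface₀ b + coface₀ c - coface₀ d := by
  funext X Y Z T U f g l m
  simp [coface₀]

lemma coface₁_alt (a b c d : Fam₃ F) : coface₁ (a - b + c - d) =
    coface₁ a - coface₁ b + coface₁ c - coface₁ d := by
  funext X Y Z T U f g l m
  simp [coface₁, -Pseudofunctor.map₂_associator]

lemma coface₂_alt (a b c d : Fam₃ F) : coface₂ (a - b + c - d) =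
    coface₂ a - coface₂ b + coface₂ c - coface₂ d := by
  funext X Y Z T U f g l m
  simp [coface₂, -Pseudofunctor.map₂_whisker_left]

lemma coface₃_alt (a b c d : Fam₃ F) : coface₃ (a - b + c - d) =
    coface₃ a - coface₃ b + coface₃ c - coface₃ d := by
  funext X Y Z T U f g l m
  simp [coface₃]

lemma coface₄_alt (a b c d : Fam₃ F) : coface₄ (a - b + c - d) =
    coface₄ a - coface₄ b + coface₄ c - coface₄ d := by
  funext X Y Z T U f g l m
  simp [coface₄, -Pseudofunctor.map₂_associator, -Pseudofunctor.map₂_whisker_left]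

variable (F)

lemma d₃_d₂ (φ : X₂ F) : d₃ K F (d₂ K F φ) = 0 := by
  have h₁ := coface₁_compR_hat φ.fam
  have h₂ := coface₂_compR_hat φ.fam
  have h₃ := coface₃_compR_hat φ.fam
  have h₄ := coface₄_compR_hat φ.fam
  have h₅ := coface₂_compL_hat φ.isNat
  have h₆ := coface₃_compL_hat φ.fam
  have h₇ := coface₄_compL_hat φ.fam
  have h₈ := coface₃_compR_hat' φ.isNat
  have h₉ := coface₄_compR_hat' φ.fam
  have h₁₀ := coface₄_compL_hat' φ.fam
  refine X₄.ext ?_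
  change coface₀ (compR (hat F) φ.fam - compL φ.fam (hat F) + compR φ.fam (hat F) - compL (hat F) φ.fam) -
    coface₁ (compR (hat F) φ.fam - compL φ.fam (hat F) + compR φ.fam (hat F) - compL (hat F) φ.fam) +
    coface₂ (compR (hat F) φ.fam - compL φ.fam (hat F) + compR φ.fam (hat F) - compL (hat F) φ.fam) -
    coface₃ (compR (hat F) φ.fam - compL φ.fam (hat F) + compR φ.fam (hat F) - compL (hat F) φ.fam) +
    coface₄ (compR (hat F) φ.fam - compL φ.fam (hat F) + compR φ.fam (hat F) - compL (hat F) φ.fam) = 0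
  rw [coface₀_alt, coface₁_alt, coface₂_alt, coface₃_alt, coface₄_alt,
    h₁, h₂, h₃, h₄, h₅, h₆, h₇, h₈, h₉, h₁₀]
  abel

/-- The coboundary `δ : X²(F) ⟶ X³(F)`, with values in the 3-cocycles. -/
def toCocycles₃ : X₂ F →ₗ[K] LinearMap.ker (d₃ K F) :=
  (d₂ K F).codRestrict (LinearMap.ker (d₃ K F)) (d₃_d₂ K F)

/-- The cohomology `H³(X^•(F))`: 3-cocycles modulo 3-coboundaries. -/
abbrev H₃ := LinearMap.ker (d₃ K F) ⧸ LinearMap.range (toCocycles₃ K F)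

/-- The cohomology class of a 3-cocycle. -/
def classOf (Ψ : LinearMap.ker (d₃ K F)) : H₃ K F := Submodule.Quotient.mk Ψ

end Complex

/-! ### Coefficients of a deformation and the obstruction -/

namespace NthOrderDeformation

variable {K : Type uK} [Field K]
  {B : Type u₁} [Bicategory.{w₁, v₁} B] [PreadditiveBicategory B] [LinearBicategory K B]
  {C : Type u₂} [Bicategory.{w₂, v₂} C] [PreadditiveBicategory C] [LinearBicategory K C]
  {F : Pseudofunctor B C} [LinearPseudofunctor K F] {n : ℕ}

/-- A 1-morphism of `B` as a 1-morphism of `B[h]/(h^{n+1})`. -/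
abbrev lift (n : ℕ) {X Y : B} (f : X ⟶ Y) : (⟨X⟩ : TruncExt n B) ⟶ ⟨Y⟩ := TruncExt.Hom.mk f

/-- The coefficient of `h^k` in the 2-isomorphism `F_h(g) ∘ F_h(f) ⟶ F_h(g ∘ f)`. -/
def hatCoeff (D : NthOrderDeformation K F n) (k : ℕ) : Fam₂ F := fun _ _ _ f g =>
  TruncExt.coeff (D.mapComp (lift n f) (lift n g)).inv k

/-- The coefficient of `h^k` in the 2-isomorphism `F_h(id_X) ⟶ id_{F_h(X)}`. -/
def unitCoeff (D : NthOrderDeformation K F n) (k : ℕ) (X : B) :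
    F.map (𝟙 X) ⟶ 𝟙 (F.obj X) :=
  TruncExt.coeff (D.mapId ⟨X⟩).hom k

lemma map₂_constHom {X Y : B} {f f' : X ⟶ Y} (η : f ⟶ f') :
    (truncMap K F n).map₂ (TruncExt.constHom η : lift n f ⟶ lift n f') =
      TruncExt.constHom (F.map₂ η) := TruncExt.hom₂_ext fun k => by
  change F.map₂ (if k = 0 then η else 0) = if k = 0 then F.map₂ η else 0
  split_ifs
  · rfl
  · exact (map₂Hom K F _ _).map_zero

lemma constHom_whiskerRight {X Y Z : B} {f f' : X ⟶ Y} (η : f ⟶ f') (g : Y ⟶ Z) :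
    (TruncExt.constHom η : lift n f ⟶ lift n f') ▷ lift n g =
      (TruncExt.constHom (η ▷ g) : lift n (f ≫ g) ⟶ lift n (f' ≫ g)) :=
  TruncExt.whiskerR_constHom _ _

lemma whiskerLeft_constHom {X Y Z : B} (f : X ⟶ Y) {g g' : Y ⟶ Z} (η : g ⟶ g') :
    lift n f ◁ (TruncExt.constHom η : lift n g ⟶ lift n g') =
      (TruncExt.constHom (f ◁ η) : lift n (f ≫ g) ⟶ lift n (f ≫ g')) :=
  TruncExt.whiskerL_constHom _ _

lemma isNat_hatCoeff (D : NthOrderDeformation K F n) (k : ℕ) : IsNat₂ (D.hatCoeff k) where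
  nat₁ {_ _ _ f f'} η g := by
    have h := D.map₂_whisker_right (TruncExt.constHom η : lift n f ⟶ lift n f') (lift n g)
    rw [← Iso.inv_comp_eq, constHom_whiskerRight, map₂_constHom, map₂_constHom] at h
    have h' := congrArg (fun θ => TruncExt.coeff θ k) h
    have e := TruncExt.whiskerR_constHom
      (f := (truncMap K F n).map (lift n f)) (f' := (truncMap K F n).map (lift n f'))
      (F.map₂ η) ((truncMap K F n).map (lift n g))
    have h₂ := (congrArg (fun τ => TruncExt.coeff (τ ≫ (D.mapComp (lift n f') (lift n g)).inv) k)
      e).trans (TruncExt.coeff_constHom_comp _ _ k)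
    exact h₂.symm.trans (h'.symm.trans (TruncExt.coeff_comp_constHom _ _ k))
  nat₂ {_ _ _} f {g g'} η := by
    have h := D.map₂_whisker_left (lift n f) (TruncExt.constHom η : lift n g ⟶ lift n g')
    rw [← Iso.inv_comp_eq, whiskerLeft_constHom, map₂_constHom, map₂_constHom] at h
    have h' := congrArg (fun θ => TruncExt.coeff θ k) h
    have e := TruncExt.whiskerL_constHom ((truncMap K F n).map (lift n f))
      (g := (truncMap K F n).map (lift n g)) (g' := (truncMap K F n).map (lift n g'))
      (F.map₂ η)
    have h₂ := (congrArg (fun τ => TruncExt.coeff (τ ≫ (D.mapComp (lift n f) (lift n g')).inv) k)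
      e).trans (TruncExt.coeff_constHom_comp _ _ k)
    exact h₂.symm.trans (h'.symm.trans (TruncExt.coeff_comp_constHom _ _ k))

/-- The family `F̂^k`, as an element of `X²(F)`. -/
def cochain (D : NthOrderDeformation K F n) (k : ℕ) : X₂ F :=
  ⟨D.hatCoeff k, D.isNat_hatCoeff k⟩

/-- The obstruction `Ψ ∈ X³(F)` to an extension of the deformation to order `n + 1`:
`Ψ(f, g, l) = ∑ F̂^p(g ∘ f, l) · (1_{F(l)} ∘ F̂^q(f, g)) - ∑ F̂^p(f, l ∘ g) · (F̂^q(g, l) ∘ 1_{F(f)})`,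
both sums over `p + q = n + 1` with `0 ≤ p, q ≤ n`. -/
def obstruction (D : NthOrderDeformation K F n) : X₃ F :=
  ∑ p ∈ (antidiagonal (n + 1)).filter (fun p => p.1 ≤ n ∧ p.2 ≤ n),
    (⟨compL (D.hatCoeff p.1) (D.hatCoeff p.2),
      (D.isNat_hatCoeff p.1).compL (D.isNat_hatCoeff p.2)⟩ : X₃ F) -
  ∑ p ∈ (antidiagonal (n + 1)).filter (fun p => p.1 ≤ n ∧ p.2 ≤ n),
    (⟨compR (D.hatCoeff p.1) (D.hatCoeff p.2),
      (D.isNat_hatCoeff p.1).compR (D.isNat_hatCoeff p.2)⟩ : X₃ F)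

/-- A deformation of order `n + 1` extends one of order `n` if the pseudofunctorial structures
agree in all orders up to `n`. -/
def Extends (D' : NthOrderDeformation K F (n + 1)) (D : NthOrderDeformation K F n) : Prop :=
  ∀ k ≤ n, D'.hatCoeff k = D.hatCoeff k ∧ D'.unitCoeff k = D.unitCoeff k

end NthOrderDeformation
end PseudoDeformation

namespace PseudoDeformation

universe w₁ w₂ v₁ v₂ u₁ u₂ uK

/-! ### Units of a pseudofunctor are determined by its composition constraints -/

section Unit

variable {C : Type u₂} [Bicategory.{w₂, v₂} C]

/-! Write `φ k` for the coefficients of a power series of candidate composition constraints and A_k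
for the coefficient of h^k in the defect of its associativity axiom (`assocDefect`). A deformation
of order n has A_k = 0 for all k ≤ n. In order n + 1 the pairs of degrees (p, q) split into those
with p, q ≤ n, which contribute Ψ, and the two pairs (0, n + 1) and (n + 1, 0), which pair `φ (n +
1)` with F̂ and contribute -δ(`φ (n + 1)`). Hence A_{n+1} = Ψ - δ(`φ (n + 1)`) (`assocDefect_succ`),
and associativity in the new order is the equation δφ = Ψ.

That Ψ is a cocycle comes from the pentagon of bracketings of four composable 1-morphisms. The five
cofaces of a defect are the five edges of the pentagon; each vertex lies on two edges and occurs
there with opposite signs. With power series in place of F̂ throughout, the cancellation gives a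
convolution identity in each degree (`sum_cofaceSum_assocDefect`). If A_j = 0 for j < k, only the
summand padded with `φ 0` = F̂ survives, and it is δA_k (`cofaceSum_assocDefect_eq_zero`). Since the
given deformation, continued by zero, has A_{n+1} = Ψ, this yields δΨ = 0.

To turn a solution of δφ = Ψ into a pseudofunctor one needs invertible constraints and units.
Invertibility is automatic, because the constant term is invertible and h is nilpotent
(`isIso_of_isIso_coeff_zero`). Units carry no independent information: once identities go to
1-morphisms isomorphic to identities, the left unit axiom at an identity determines the unit
constraint, and the remaining unit axioms follow from naturality and associativity
(`exists_pseudofunctorialStructure`). The same uniqueness makes the units of the extension agree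
with the given ones up to order n (`unitCoeff_eq`). -/

/-- Right whiskering with a 1-morphism isomorphic to an identity is faithful. -/
lemma whiskerRight_cancel_of_iso_id {X Y : C} {g : Y ⟶ Y} (j : g ≅ 𝟙 Y) {a b : X ⟶ Y}
    {η θ : a ⟶ b} (h : η ▷ g = θ ▷ g) : η = θ := by
  -- Whiskering with an identity is conjugation by right unitors. Transporting this along `j`
  -- recovers `ξ` from `ξ ▷ g`.
  have key : ∀ ξ : a ⟶ b, ξ = (ρ_ a).inv ≫ a ◁ j.inv ≫ ξ ▷ g ≫ b ◁ j.hom ≫ (ρ_ b).hom := by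
    intro ξ
    rw [← whisker_exchange_assoc, ← whiskerLeft_comp_assoc]
    simp
  rw [key η, key θ, h]

/-- Right whiskering with a 1-morphism isomorphic to an identity is full. -/
lemma whiskerRight_preimage_of_iso_id {X Y : C} {g : Y ⟶ Y} (j : g ≅ 𝟙 Y) {a b : X ⟶ Y}
    (β : a ≫ g ⟶ b ≫ g) :
    ((ρ_ a).inv ≫ a ◁ j.inv ≫ β ≫ b ◁ j.hom ≫ (ρ_ b).hom) ▷ g = β := by
  rw [← cancel_mono (b ◁ j.hom), ← whisker_exchange, whiskerRight_id]
  simp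

variable {B : Type u₁} [Bicategory.{w₁, v₁} B]

/-- The unit constraints are determined by the composition constraints. -/
lemma eq_of_whiskerRight_map_id {F : Pseudofunctor B C} {X : B} {u v : F.map (𝟙 X) ⟶ 𝟙 (F.obj X)}
    (h : u ▷ F.map (𝟙 X) ≫ (λ_ (F.map (𝟙 X))).hom = v ▷ F.map (𝟙 X) ≫ (λ_ (F.map (𝟙 X))).hom) :
    u = v :=
  whiskerRight_cancel_of_iso_id (F.mapId X) ((cancel_mono _).mp h)

/-- Composition constraints that satisfy naturality and the associativity axiom are part of a
pseudofunctorial structure as soon as identities are sent to 1-morphisms isomorphic to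
identities. -/
theorem exists_pseudofunctorialStructure {P : PrelaxFunctor B C}
    (c : ∀ {X Y Z : B} (f : X ⟶ Y) (g : Y ⟶ Z), P.map (f ≫ g) ≅ P.map f ≫ P.map g)
    (hl : ∀ {X Y Z : B} (f : X ⟶ Y) {g h : Y ⟶ Z} (η : g ⟶ h),
      P.map f ◁ P.map₂ η ≫ (c f h).inv = (c f g).inv ≫ P.map₂ (f ◁ η))
    (hr : ∀ {X Y Z : B} {f g : X ⟶ Y} (η : f ⟶ g) (h : Y ⟶ Z),
      P.map₂ η ▷ P.map h ≫ (c g h).inv = (c f h).inv ≫ P.map₂ (η ▷ h))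
    (ha : ∀ {X Y Z T : B} (f : X ⟶ Y) (g : Y ⟶ Z) (h : Z ⟶ T),
      P.map f ◁ (c g h).inv ≫ (c f (g ≫ h)).inv =
        (α_ (P.map f) (P.map g) (P.map h)).inv ≫ (c f g).inv ▷ P.map h ≫ (c (f ≫ g) h).inv ≫
          P.map₂ (α_ f g h).hom)
    (e : ∀ X : B, P.map (𝟙 X) ≅ 𝟙 (P.obj X)) :
    ∃ S : PseudofunctorialStructure P,
      ∀ {X Y Z : B} (f : X ⟶ Y) (g : Y ⟶ Z), S.mapComp f g = c f g := by
  -- The left unit axiom at `𝟙 X` prescribes the unit constraint whiskered with `P.map (𝟙 X)`: it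
  -- must be `β X`. The constraint `ι X` is the unique preimage; `e X` serves only to solve for it
  -- and need not equal it.
  let β (X : B) : P.map (𝟙 X) ≫ P.map (𝟙 X) ≅ 𝟙 (P.obj X) ≫ P.map (𝟙 X) :=
    (c (𝟙 X) (𝟙 X)).symm ≪≫ P.map₂Iso (λ_ (𝟙 X)) ≪≫ (λ_ _).symm
  let ι (X : B) : P.map (𝟙 X) ≅ 𝟙 (P.obj X) :=
    (ρ_ _).symm ≪≫ whiskerLeftIso _ (e X).symm ≪≫ β X ≪≫ whiskerLeftIso _ (e X) ≪≫ ρ_ _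
  have hι (X : B) : (ι X).hom ▷ P.map (𝟙 X) ≫ (λ_ _).hom =
      (c (𝟙 X) (𝟙 X)).inv ≫ P.map₂ (λ_ (𝟙 X)).hom := by
    have h := whiskerRight_preimage_of_iso_id (e X) (β X).hom
    change (ι X).hom ▷ _ = _ at h
    simp [h, β]
  have hlu {X Y : B} (f : X ⟶ Y) : (ι X).hom ▷ P.map f ≫ (λ_ (P.map f)).hom =
      (c (𝟙 X) f).inv ≫ P.map₂ (λ_ f).hom := by
    -- Put u_f = `(c (𝟙 X) f).inv ≫ P.map₂ (λ_ f).hom`. Associativity at (`𝟙 X`, `𝟙 X`, `f`) and the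
    -- triangle identity relate u_f, whiskered on the left, to u at `𝟙 X`, whiskered on the right;
    -- the latter is known from `hι`.
    have h₁ : P.map (𝟙 X) ◁ ((c (𝟙 X) f).inv ≫ P.map₂ (λ_ f).hom) =
        (α_ _ _ _).inv ≫ ((c (𝟙 X) (𝟙 X)).inv ≫ P.map₂ (λ_ (𝟙 X)).hom) ▷ P.map f := by
      rw [← cancel_mono (c (𝟙 X) f).inv]
      simp only [whiskerLeft_comp, comp_whiskerRight, Category.assoc]
      rw [hl, hr, ← Category.assoc, ha]
      simp only [Category.assoc]
      rw [← P.map₂_comp]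
      rw [triangle, unitors_equal]
    rw [← hι X] at h₁
    -- Interchanging `ι X` with u_f and inserting `h₁` puts a whiskered copy of `ι X` first on both
    -- sides. It is invertible, and cancelling it leaves the left unit axiom for `f`.
    have h₂ := whisker_exchange (ι X).hom ((c (𝟙 X) f).inv ≫ P.map₂ (λ_ f).hom)
    rw [h₁] at h₂
    have h₃ : ((α_ (P.map (𝟙 X)) (P.map (𝟙 X)) (P.map f)).inv ≫
        ((ι X).hom ▷ P.map (𝟙 X) ≫ (λ_ (P.map (𝟙 X))).hom) ▷ P.map f) ≫ (ι X).hom ▷ P.map f =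
        (ι X).hom ▷ (P.map (𝟙 X) ≫ P.map f) ≫ (λ_ _).hom ≫ (ι X).hom ▷ P.map f := by simp
    rw [h₃, cancel_epi, id_whiskerLeft, cancel_epi] at h₂
    rw [h₂]
    simp
  have hru {X Y : B} (f : X ⟶ Y) : P.map f ◁ (ι Y).hom ≫ (ρ_ (P.map f)).hom =
      (c f (𝟙 Y)).inv ≫ P.map₂ (ρ_ f).hom := by
    -- It suffices to compare after whiskering with `P.map (𝟙 Y)`. There, associativity at (`f`, `𝟙
    -- Y`, `𝟙 Y`) and the triangle identity turn the right unit axiom into the left one at `𝟙 Y`.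
    refine whiskerRight_cancel_of_iso_id (e Y) ?_
    rw [← cancel_mono (c f (𝟙 Y)).inv]
    simp only [comp_whiskerRight, Category.assoc]
    rw [hr, ← cancel_epi (α_ _ _ _).inv]
    have h₁ := ha f (𝟙 Y) (𝟙 Y)
    have h₂ : P.map f ◁ ((c (𝟙 Y) (𝟙 Y)).inv ≫ P.map₂ (λ_ (𝟙 Y)).hom) ≫ (c f (𝟙 Y)).inv =
        (α_ _ _ _).inv ≫ (c f (𝟙 Y)).inv ▷ P.map (𝟙 Y) ≫ (c (f ≫ 𝟙 Y) (𝟙 Y)).inv ≫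
          P.map₂ ((ρ_ f).hom ▷ 𝟙 Y) := by
      rw [whiskerLeft_comp, Category.assoc, hl, reassoc_of% h₁, ← P.map₂_comp, triangle]
    rw [← h₂, ← hlu]
    simp
  exact ⟨{ mapId := ι
           mapComp := c
           map₂_whisker_left := fun f g h η => by rw [hl, Iso.hom_inv_id_assoc]
           map₂_whisker_right := fun η h => by rw [hr, Iso.hom_inv_id_assoc]
           map₂_associator := fun f g h => by
            rw [ha, Iso.hom_inv_id_assoc, hom_inv_whiskerRight_assoc, Iso.hom_inv_id_assoc]
           map₂_left_unitor := fun f => by rw [hlu, Iso.hom_inv_id_assoc]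
           map₂_right_unitor := fun f => by rw [hru, Iso.hom_inv_id_assoc] }, fun f g => rfl⟩

end Unit

/-! ### The pentagon identity for associativity defects -/

section Pentagon

variable {B : Type u₁} [Bicategory.{w₁, v₁} B]
  {C : Type u₂} [Bicategory.{w₂, v₂} C] [PreadditiveBicategory C] {F : Pseudofunctor B C}

/-- The first coface of `χ`, padded with a family `ψ` in place of `F̂`. -/
def cofaceHom₀ (ψ : Fam₂ F) : Fam₃ F →+ Fam₄ F :=
  AddMonoidHom.mk' (fun χ _ _ _ _ _ f g l m => F.map f ◁ χ g l m ≫ ψ f (g ≫ l ≫ m))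
    fun χ χ' => by
      funext X Y Z T U f g l m
      simp

/-- The coface `χ(g ∘ f, l, m)`, padded with a family `ψ` in place of `F̂`. -/
def cofaceHom₁ (ψ : Fam₂ F) : Fam₃ F →+ Fam₄ F :=
  AddMonoidHom.mk' (fun χ _ _ _ _ _ f g l m =>
      (α_ (F.map f) (F.map g) (F.map l ≫ F.map m)).inv ≫ ψ f g ▷ (F.map l ≫ F.map m) ≫
        χ (f ≫ g) l m ≫ F.map₂ (α_ f g (l ≫ m)).hom)
    fun χ χ' => by
      funext X Y Z T U f g l m
      simp [-Pseudofunctor.map₂_associator]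

/-- The coface `χ(f, l ∘ g, m)`, padded with a family `ψ` in place of `F̂`. -/
def cofaceHom₂ (ψ : Fam₂ F) : Fam₃ F →+ Fam₄ F :=
  AddMonoidHom.mk' (fun χ _ _ _ _ _ f g l m =>
      F.map f ◁ ((α_ (F.map g) (F.map l) (F.map m)).inv ≫ ψ g l ▷ F.map m) ≫
        χ f (g ≫ l) m ≫ F.map₂ (f ◁ (α_ g l m).hom))
    fun χ χ' => by
      funext X Y Z T U f g l m
      simp [-Pseudofunctor.map₂_whisker_left]

/-- The coface `χ(f, g, m ∘ l)`, padded with a family `ψ` in place of `F̂`. -/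
def cofaceHom₃ (ψ : Fam₂ F) : Fam₃ F →+ Fam₄ F :=
  AddMonoidHom.mk' (fun χ _ _ _ _ _ f g l m => F.map f ◁ F.map g ◁ ψ l m ≫ χ f g (l ≫ m))
    fun χ χ' => by
      funext X Y Z T U f g l m
      simp

/-- The last coface of `χ`, padded with a family `ψ` in place of `F̂`. -/
def cofaceHom₄ (ψ : Fam₂ F) : Fam₃ F →+ Fam₄ F :=
  AddMonoidHom.mk' (fun χ _ _ _ _ _ f g l m =>
      F.map f ◁ (α_ (F.map g) (F.map l) (F.map m)).inv ≫
        (α_ (F.map f) (F.map g ≫ F.map l) (F.map m)).inv ≫ χ f g l ▷ F.map m ≫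
        ψ (f ≫ g ≫ l) m ≫ F.map₂ ((α_ f (g ≫ l) m).hom ≫ f ◁ (α_ g l m).hom))
    fun χ χ' => by
      funext X Y Z T U f g l m
      simp [-Pseudofunctor.map₂_associator, -Pseudofunctor.map₂_whisker_left]

/-- The alternating sum of the cofaces padded with a family `ψ`. -/
def cofaceSum (ψ : Fam₂ F) : Fam₃ F →+ Fam₄ F :=
  cofaceHom₀ ψ - cofaceHom₁ ψ + cofaceHom₂ ψ - cofaceHom₃ ψ + cofaceHom₄ ψ

/-- This and the next four identities are the five vertices of the pentagon. A bracketing of four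
factors is a composite of three constraints and can be read as a coface along either of its two
edges; changing the edge permutes the roles of the three families. -/
lemma cofaceHom₃_compR (ψ φ χ : Fam₂ F) :
    cofaceHom₃ ψ (compR φ χ) = cofaceHom₀ φ (compR χ ψ) := by
  funext X Y Z T U f g l m
  simp only [cofaceHom₃, cofaceHom₀, AddMonoidHom.mk'_apply, compR, Category.assoc,
    whiskerLeft_comp]

lemma cofaceHom₂_compR (ψ : Fam₂ F) {φ : Fam₂ F} (hφ : IsNat₂ φ) (χ : Fam₂ F) :
    cofaceHom₂ ψ (compR φ χ) = cofaceHom₀ φ (compL χ ψ) := by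
  funext X Y Z T U f g l m
  simp only [cofaceHom₂, cofaceHom₀, AddMonoidHom.mk'_apply, compR, compL, Category.assoc,
    whiskerLeft_comp]
  rw [hφ.nat₂]

lemma cofaceHom₂_compL (ψ φ χ : Fam₂ F) :
    cofaceHom₂ ψ (compL φ χ) = cofaceHom₄ φ (compR χ ψ) := by
  funext X Y Z T U f g l m
  simp only [cofaceHom₂, cofaceHom₄, AddMonoidHom.mk'_apply, compR, compL, Category.assoc,
    whiskerLeft_comp, comp_whiskerRight, F.map₂_comp]
  rw [associator_inv_naturality_middle_assoc]

/-- At this vertex all factors are bracketed to the left, so both readings must be rebracketed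
completely. They differ by the pentagon identities in source and target, which naturality of `φ`
brings together. -/
lemma cofaceHom₁_compL (ψ : Fam₂ F) {φ : Fam₂ F} (hφ : IsNat₂ φ) (χ : Fam₂ F) :
    cofaceHom₁ ψ (compL φ χ) = cofaceHom₄ φ (compL χ ψ) := by
  funext X Y Z T U f g l m
  simp only [cofaceHom₁, cofaceHom₄, AddMonoidHom.mk'_apply, compL, Category.assoc,
    comp_whiskerRight]
  rw [hφ.nat₁_assoc, ← F.map₂_comp, ← F.map₂_comp, pentagon]
  simp only [whiskerRight_comp, Category.assoc, Iso.hom_inv_id_assoc, pentagon_inv_assoc]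

/-- At the balanced vertex the first two and the last two factors are composed independently. The
interchange law makes the order irrelevant, so `ψ` and `χ` trade places. -/
lemma cofaceHom₃_compL (ψ φ χ : Fam₂ F) :
    cofaceHom₃ ψ (compL φ χ) = cofaceHom₁ χ (compR φ ψ) := by
  funext X Y Z T U f g l m
  simp only [cofaceHom₃, cofaceHom₁, AddMonoidHom.mk'_apply, compL, compR, Category.assoc]
  rw [associator_inv_naturality_right_assoc, whisker_exchange_assoc]

/-- The coefficient of `h^k` in the defect of the associativity axiom for `∑ φ_k h^k`. -/
def assocDefect (φ : ℕ → Fam₂ F) (k : ℕ) : Fam₃ F :=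
  ∑ p ∈ antidiagonal k, (compL (φ p.1) (φ p.2) - compR (φ p.1) (φ p.2))

/-- Here the degree of the inner family comes first, as in the vertical product of polynomials;
`compL` and `compR` list the outer family first, whence the swaps. -/
lemma assocDefect_apply (φ : ℕ → Fam₂ F) (k : ℕ) {X Y Z T : B} (f : X ⟶ Y) (g : Y ⟶ Z)
    (l : Z ⟶ T) : assocDefect φ k f g l =
      ∑ p ∈ antidiagonal k, (α_ (F.map f) (F.map g) (F.map l)).inv ≫ φ p.1 f g ▷ F.map l ≫
        φ p.2 (f ≫ g) l ≫ F.map₂ (α_ f g l).hom -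
      ∑ p ∈ antidiagonal k, F.map f ◁ φ p.1 g l ≫ φ p.2 f (g ≫ l) := by
  rw [← Finset.Nat.sum_antidiagonal_swap, ← Finset.Nat.sum_antidiagonal_swap (n := k)
    (f := fun p => F.map f ◁ φ p.1 g l ≫ φ p.2 f (g ≫ l)), ← Finset.sum_sub_distrib, assocDefect]
  simp only [Finset.sum_apply]
  rfl

/-- Both sides run over all triples of sum `k`, and a cyclic shift permutes these. Four of the five
pentagon vertices shift the degrees in this way. -/
lemma sum_antidiagonal_rotate {M : Type*} [AddCommMonoid M] (G : ℕ → ℕ → ℕ → M) (k : ℕ) :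
    ∑ x ∈ antidiagonal k, ∑ y ∈ antidiagonal x.2, G y.1 y.2 x.1 =
      ∑ x ∈ antidiagonal k, ∑ y ∈ antidiagonal x.2, G x.1 y.1 y.2 := by
  rw [Finset.sum_sigma', Finset.sum_sigma']
  refine Finset.sum_bij' (fun x _ => ⟨(x.2.1, x.2.2 + x.1.1), (x.2.2, x.1.1)⟩)
    (fun x _ => ⟨(x.2.2, x.1.1 + x.2.1), (x.1.1, x.2.1)⟩) ?_ ?_ ?_ ?_ ?_ <;>
  · rintro ⟨⟨a, b⟩, ⟨c, d⟩⟩ h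
    simp only [Finset.mem_sigma, mem_antidiagonal] at h
    obtain ⟨rfl, rfl⟩ := h
    simp [add_comm, add_left_comm]

/-- The balanced vertex reverses the three degrees; reversal is the cyclic shift followed by a
transposition. -/
lemma sum_antidiagonal_reverse {M : Type*} [AddCommMonoid M] (G : ℕ → ℕ → ℕ → M) (k : ℕ) :
    ∑ x ∈ antidiagonal k, ∑ y ∈ antidiagonal x.2, G y.2 y.1 x.1 =
      ∑ x ∈ antidiagonal k, ∑ y ∈ antidiagonal x.2, G x.1 y.1 y.2 := by
  rw [← sum_antidiagonal_rotate G]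
  refine Finset.sum_congr rfl fun x _ => ?_
  exact Finset.Nat.sum_antidiagonal_swap (f := fun y => G y.1 y.2 x.1)

/-- The two ways around the pentagon agree, for an arbitrary power series of natural
families. -/
theorem sum_cofaceSum_assocDefect {φ : ℕ → Fam₂ F} (hφ : ∀ k, IsNat₂ (φ k)) (k : ℕ) :
    ∑ p ∈ antidiagonal k, cofaceSum (φ p.1) (assocDefect φ p.2) = 0 := by
  -- Five of the ten terms are rewritten by the vertex identities, so that they differ from the
  -- other five only in sign and in the permutation of degrees.
  have h (x : ℕ × ℕ) : cofaceSum (φ x.1) (assocDefect φ x.2) =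
      ∑ y ∈ antidiagonal x.2, (
        cofaceHom₀ (φ x.1) (compL (φ y.1) (φ y.2)) - cofaceHom₀ (φ x.1) (compR (φ y.1) (φ y.2)) -
        cofaceHom₄ (φ y.1) (compL (φ y.2) (φ x.1)) + cofaceHom₁ (φ x.1) (compR (φ y.1) (φ y.2)) +
        cofaceHom₄ (φ y.1) (compR (φ y.2) (φ x.1)) - cofaceHom₀ (φ y.1) (compL (φ y.2) (φ x.1)) -
        cofaceHom₁ (φ y.2) (compR (φ y.1) (φ x.1)) + cofaceHom₀ (φ y.1) (compR (φ y.2) (φ x.1)) +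
        cofaceHom₄ (φ x.1) (compL (φ y.1) (φ y.2)) -
          cofaceHom₄ (φ x.1) (compR (φ y.1) (φ y.2))) := by
    rw [assocDefect, map_sum]
    refine Finset.sum_congr rfl fun y _ => ?_
    simp only [cofaceSum, AddMonoidHom.add_apply, AddMonoidHom.sub_apply, map_sub,
      cofaceHom₁_compL _ (hφ _), cofaceHom₂_compL, cofaceHom₃_compL, cofaceHom₂_compR _ (hφ _),
      cofaceHom₃_compR]
    abel
  simp only [h, Finset.sum_add_distrib, Finset.sum_sub_distrib]
  rw [sum_antidiagonal_rotate fun a b c => cofaceHom₄ (φ a) (compL (φ b) (φ c)),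
    sum_antidiagonal_rotate fun a b c => cofaceHom₄ (φ a) (compR (φ b) (φ c)),
    sum_antidiagonal_rotate fun a b c => cofaceHom₀ (φ a) (compL (φ b) (φ c)),
    sum_antidiagonal_rotate fun a b c => cofaceHom₀ (φ a) (compR (φ b) (φ c)),
    sum_antidiagonal_reverse fun a b c => cofaceHom₁ (φ a) (compR (φ b) (φ c))]
  abel

/-- If the associativity axiom holds below order `k`, then its defect in order `k` is a
cocycle. -/
theorem cofaceSum_assocDefect_eq_zero {φ : ℕ → Fam₂ F} (hφ : ∀ k, IsNat₂ (φ k)) {k : ℕ}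
    (h : ∀ j < k, assocDefect φ j = 0) : cofaceSum (φ 0) (assocDefect φ k) = 0 := by
  -- A padding of positive degree leaves a defect of degree below `k`, which vanishes.
  rw [← sum_cofaceSum_assocDefect hφ k, Finset.sum_eq_single (0, k)]
  · rintro ⟨a, b⟩ hab hne
    have hb : b < k := by
      simp only [mem_antidiagonal] at hab
      rcases Nat.eq_zero_or_pos a with rfl | ha
      · exact absurd (by simpa using hab) hne
      · omega
    rw [h b hb, map_zero]
  · simp

end Pentagon

/-! ### 2-morphisms of the truncated polynomial extension -/

namespace TruncExt

section RightInverse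

variable {A : Type u₁} [Category.{v₁} A] [Preadditive A] {a b : A}

/-- The coefficients of a right inverse of a power series with invertible constant term. -/
noncomputable def rightInvCoeff (σ : ℕ → (a ⟶ b)) [IsIso (σ 0)] : ℕ → (b ⟶ a)
  | k => if k = 0 then inv (σ 0) else
      -(inv (σ 0) ≫ ∑ i : Fin k, σ (k - i) ≫ rightInvCoeff σ i)
  decreasing_by exact i.2

lemma sum_comp_rightInvCoeff (σ : ℕ → (a ⟶ b)) [IsIso (σ 0)] (k : ℕ) :
    ∑ p ∈ antidiagonal k, σ p.1 ≫ rightInvCoeff σ p.2 = if k = 0 then 𝟙 a else 0 := by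
  -- In this order the last summand is `σ 0` composed with the `k`-th coefficient of the inverse.
  -- For `k > 0` the recursion chooses that coefficient so as to cancel the earlier summands.
  rw [← Finset.Nat.sum_antidiagonal_swap, Finset.Nat.sum_antidiagonal_eq_sum_range_succ_mk,
    Finset.sum_range_succ]
  simp only [Prod.fst_swap, Prod.snd_swap, Nat.sub_self]
  rw [rightInvCoeff]
  split_ifs with hk
  · subst hk
    simp
  · rw [Finset.sum_range fun i => σ (k - i) ≫ rightInvCoeff σ i]
    simp

end RightInverse

variable {n : ℕ} {B : Type u₁} [Bicategory.{w₁, v₁} B] [PreadditiveBicategory B]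

/-- The truncation of a power series as a 2-morphism of `B[h]/(h^{n+1})`. -/
def ofCoeff {X Y : TruncExt n B} {f g : X ⟶ Y} (c : ℕ → (Hom.hom f ⟶ Hom.hom g)) : f ⟶ g :=
  show Hom₂ _ _ from
  { coeff := fun k => if k ≤ n then c k else 0
    coeff_eq_zero := fun _ hk => if_neg (by omega) }

lemma coeff_ofCoeff {X Y : TruncExt n B} {f g : X ⟶ Y} (c : ℕ → (Hom.hom f ⟶ Hom.hom g)) {k : ℕ}
    (hk : k ≤ n) : coeff (ofCoeff c : f ⟶ g) k = c k := if_pos hk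

/-- The right inverse is built recursively. Invertibility of its constant term is recorded so that
the construction can be applied to it again. -/
lemma exists_comp_eq_id {X Y : TruncExt n B} {f g : X ⟶ Y} (σ : f ⟶ g) (hσ : IsIso (coeff σ 0)) :
    ∃ τ : g ⟶ f, σ ≫ τ = 𝟙 f ∧ IsIso (coeff τ 0) := by
  refine ⟨ofCoeff (rightInvCoeff (coeff σ)), hom₂_ext fun k => ?_, ?_⟩
  · rw [coeff_comp, coeff_id]
    by_cases hk : k ≤ n
    · rw [if_pos hk, ← sum_comp_rightInvCoeff (coeff σ) k]
      refine Finset.sum_congr rfl fun p hp => ?_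
      rw [coeff_ofCoeff _ ((Finset.HasAntidiagonal.antidiagonal.snd_le hp).trans hk)]
    · rw [if_neg hk, if_neg (by omega)]
  · rw [coeff_ofCoeff _ (Nat.zero_le n), rightInvCoeff, if_pos rfl]
    infer_instance

/-- A polynomial with invertible constant term is invertible. -/
lemma isIso_of_isIso_coeff_zero {X Y : TruncExt n B} {f g : X ⟶ Y} (σ : f ⟶ g)
    (hσ : IsIso (coeff σ 0)) : IsIso σ := by
  obtain ⟨τ, hτ, hτ₀⟩ := exists_comp_eq_id σ hσ
  obtain ⟨ρ, hρ, -⟩ := exists_comp_eq_id τ hτ₀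
  -- A right inverse of `τ` must coincide with its left inverse `σ`.
  have : σ = ρ := by
    rw [← Category.comp_id σ, ← hρ, ← Category.assoc, hτ, Category.id_comp]
  exact ⟨τ, hτ, by rw [this, hρ]⟩

lemma coeff_constHom_comp_comp_constHom {X Y : TruncExt n B} {f g l m t : X ⟶ Y}
    (s : Hom.hom f ⟶ Hom.hom g) (σ : g ⟶ l) (τ : l ⟶ m) (r : Hom.hom m ⟶ Hom.hom t) {k : ℕ}
    (hk : k ≤ n) : coeff ((constHom s : f ⟶ g) ≫ σ ≫ τ ≫ (constHom r : m ⟶ t)) k =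
      ∑ p ∈ antidiagonal k, s ≫ coeff σ p.1 ≫ coeff τ p.2 ≫ r := by
  rw [coeff_constHom_comp, coeff_comp, if_pos hk, Preadditive.comp_sum]
  simp only [coeff_comp_constHom]

end TruncExt

/-! ### The associativity and unit axioms, coefficient by coefficient -/

section Coefficients

variable (K : Type uK) [Field K]
  {B : Type u₁} [Bicategory.{w₁, v₁} B] [PreadditiveBicategory B] [LinearBicategory K B]
  {C : Type u₂} [Bicategory.{w₂, v₂} C] [PreadditiveBicategory C] [LinearBicategory K C]
  {F : Pseudofunctor B C} [LinearPseudofunctor K F] {n : ℕ}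

/-- The associativity axiom for a family of 2-morphisms of `C[h]/(h^{n+1})` in terms of its
coefficients. -/
lemma hexagon_truncMap_iff
    (a : ∀ {X Y Z : TruncExt n B} (f : X ⟶ Y) (g : Y ⟶ Z),
      (truncMap K F n).map f ≫ (truncMap K F n).map g ⟶ (truncMap K F n).map (f ≫ g))
    (φ : ℕ → Fam₂ F)
    (h : ∀ {X Y Z : TruncExt n B} (f : X ⟶ Y) (g : Y ⟶ Z), ∀ k ≤ n,
      TruncExt.coeff (a f g) k = φ k (TruncExt.Hom.hom f) (TruncExt.Hom.hom g))
    {X Y Z T : TruncExt n B} (f : X ⟶ Y) (g : Y ⟶ Z) (l : Z ⟶ T) :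
    (truncMap K F n).map f ◁ a g l ≫ a f (g ≫ l) =
        (α_ ((truncMap K F n).map f) ((truncMap K F n).map g) ((truncMap K F n).map l)).inv ≫
          a f g ▷ (truncMap K F n).map l ≫ a (f ≫ g) l ≫ (truncMap K F n).map₂ (α_ f g l).hom ↔
      ∀ k ≤ n, assocDefect φ k (TruncExt.Hom.hom f) (TruncExt.Hom.hom g) (TruncExt.Hom.hom l) =
        0 := by
  have hL : ∀ k ≤ n, TruncExt.coeff ((truncMap K F n).map f ◁ a g l ≫ a f (g ≫ l)) k =
      ∑ p ∈ antidiagonal k, F.map (TruncExt.Hom.hom f) ◁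
        φ p.1 (TruncExt.Hom.hom g) (TruncExt.Hom.hom l) ≫
          φ p.2 (TruncExt.Hom.hom f) (TruncExt.Hom.hom g ≫ TruncExt.Hom.hom l) := by
    intro k hk
    rw [TruncExt.coeff_comp, if_pos hk]
    refine Finset.sum_congr rfl fun p hp => ?_
    rw [h f (g ≫ l) _ ((Finset.HasAntidiagonal.antidiagonal.snd_le hp).trans hk)]
    exact congrArg (fun θ => F.map (TruncExt.Hom.hom f) ◁ θ ≫ _)
      (h g l _ ((Finset.HasAntidiagonal.antidiagonal.fst_le hp).trans hk))
  -- Associators are constant polynomials, so only the two composition constraints are convolved.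
  have hα : (truncMap K F n).map₂ (α_ f g l).hom =
      TruncExt.constHom (F.map₂
        (α_ (TruncExt.Hom.hom f) (TruncExt.Hom.hom g) (TruncExt.Hom.hom l)).hom) :=
    NthOrderDeformation.map₂_constHom _
  have hR : ∀ k ≤ n, TruncExt.coeff
      ((α_ ((truncMap K F n).map f) ((truncMap K F n).map g) ((truncMap K F n).map l)).inv ≫
        a f g ▷ (truncMap K F n).map l ≫ a (f ≫ g) l ≫ (truncMap K F n).map₂ (α_ f g l).hom) k =
      ∑ p ∈ antidiagonal k, (α_ (F.map (TruncExt.Hom.hom f)) (F.map (TruncExt.Hom.hom g))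
          (F.map (TruncExt.Hom.hom l))).inv ≫
        φ p.1 (TruncExt.Hom.hom f) (TruncExt.Hom.hom g) ▷ F.map (TruncExt.Hom.hom l) ≫
          φ p.2 (TruncExt.Hom.hom f ≫ TruncExt.Hom.hom g) (TruncExt.Hom.hom l) ≫
            F.map₂ (α_ (TruncExt.Hom.hom f) (TruncExt.Hom.hom g) (TruncExt.Hom.hom l)).hom := by
    intro k hk
    rw [hα]
    refine (TruncExt.coeff_constHom_comp_comp_constHom _ _ _ _ hk).trans ?_
    refine Finset.sum_congr rfl fun p hp => ?_
    rw [h (f ≫ g) l _ ((Finset.HasAntidiagonal.antidiagonal.snd_le hp).trans hk)]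
    exact congrArg (fun θ => (α_ _ _ _).inv ≫ θ ▷ F.map (TruncExt.Hom.hom l) ≫ _)
      (h f g _ ((Finset.HasAntidiagonal.antidiagonal.fst_le hp).trans hk))
  constructor
  · intro H k hk
    have := congrArg (fun θ => TruncExt.coeff θ k) H
    simp only [hL k hk, hR k hk] at this
    rw [assocDefect_apply, this, sub_self]
  · intro H
    refine TruncExt.hom₂_ext fun k => ?_
    by_cases hk : k ≤ n
    · rw [hL k hk, hR k hk]
      have := H k hk
      rw [assocDefect_apply, sub_eq_zero] at this
      exact this.symm
    · rw [TruncExt.coeff_eq_zero _ k (by omega), TruncExt.coeff_eq_zero _ k (by omega)]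

variable {K}

/-- The left unit axiom for a pseudofunctorial structure on the extension of `F`, in terms of
coefficients. -/
lemma coeff_mapId_whiskerRight (S : PseudofunctorialStructure (truncMap K F n)) (X : B) (k : ℕ) :
    TruncExt.coeff (S.mapId ⟨X⟩).hom k ▷ F.map (𝟙 X) ≫ (λ_ (F.map (𝟙 X))).hom =
      TruncExt.coeff (S.mapComp (𝟙 (⟨X⟩ : TruncExt n B)) (𝟙 (⟨X⟩ : TruncExt n B))).inv k ≫
        F.map₂ (λ_ (𝟙 X)).hom := by
  have h := S.map₂_left_unitor (𝟙 (⟨X⟩ : TruncExt n B))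
  rw [← Iso.inv_comp_eq] at h
  have hl : (truncMap K F n).map₂ (λ_ (𝟙 (⟨X⟩ : TruncExt n B))).hom =
      TruncExt.constHom (F.map₂ (λ_ (𝟙 X)).hom) := NthOrderDeformation.map₂_constHom _
  rw [hl] at h
  -- Unitors are constant and whiskering acts coefficientwise, so the axiom involves no convolution:
  -- order `k` of the unit meets only order `k` of the composition constraint.
  exact (TruncExt.coeff_comp_constHom _ _ k).symm.trans
    ((congrArg (fun θ => TruncExt.coeff θ k) h.symm).trans (TruncExt.coeff_comp_constHom _ _ k))

end Coefficients

/-! ### Deformations as truncated series of natural families -/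

namespace NthOrderDeformation

variable {K : Type uK} [Field K]
  {B : Type u₁} [Bicategory.{w₁, v₁} B] [PreadditiveBicategory B] [LinearBicategory K B]
  {C : Type u₂} [Bicategory.{w₂, v₂} C] [PreadditiveBicategory C] [LinearBicategory K C]
  {F : Pseudofunctor B C} [LinearPseudofunctor K F] {n : ℕ}

lemma hatCoeff_zero (D : NthOrderDeformation K F n) : D.hatCoeff 0 = hat F := by
  funext X Y Z f g
  exact D.coeff_zero_mapComp _ _

lemma hatCoeff_eq_zero (D : NthOrderDeformation K F n) {k : ℕ} (hk : n < k) :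
    D.hatCoeff k = 0 := by
  funext X Y Z f g
  exact TruncExt.coeff_eq_zero _ k hk

lemma assocDefect_hatCoeff (D : NthOrderDeformation K F n) {k : ℕ} (hk : k ≤ n) :
    assocDefect D.hatCoeff k = 0 := by
  funext X Y Z T f g l
  exact (hexagon_truncMap_iff K (fun f g => (D.mapComp f g).inv) D.hatCoeff (fun _ _ _ _ => rfl)
    (lift n f) (lift n g) (lift n l)).mp
      (D.toPseudofunctor.mapComp_assoc_right_inv (lift n f) (lift n g) (lift n l)) k hk

/-- The left unit axiom at an identity expresses the order `k` unit, whiskered with `F.map (𝟙 X)`,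
through the order `k` composition constraint, and this whiskering is faithful. -/
lemma unitCoeff_eq {m : ℕ} {D : NthOrderDeformation K F n} {D' : NthOrderDeformation K F m} {k : ℕ}
    (h : D'.hatCoeff k = D.hatCoeff k) : D'.unitCoeff k = D.unitCoeff k := by
  funext X
  refine eq_of_whiskerRight_map_id ?_
  exact (coeff_mapId_whiskerRight D'.toPseudofunctorialStructure X k).trans
    ((congrArg (fun φ : Fam₂ F => φ (𝟙 X) (𝟙 X) ≫ F.map₂ (λ_ (𝟙 X)).hom) h).trans
      (coeff_mapId_whiskerRight D.toPseudofunctorialStructure X k).symm)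

/-- Natural families that satisfy the associativity axiom up to order `n` are the coefficients of
a deformation of order `n`. -/
theorem exists_hatCoeff_eq (φ : ℕ → Fam₂ F) (hφ : ∀ k, IsNat₂ (φ k)) (h₀ : φ 0 = hat F)
    (ha : ∀ k ≤ n, assocDefect φ k = 0) :
    ∃ D : NthOrderDeformation K F n, ∀ k ≤ n, D.hatCoeff k = φ k := by
  let a {X Y Z : TruncExt n B} (f : X ⟶ Y) (g : Y ⟶ Z) :
      (truncMap K F n).map f ≫ (truncMap K F n).map g ⟶ (truncMap K F n).map (f ≫ g) :=
    TruncExt.ofCoeff fun k => φ k (TruncExt.Hom.hom f) (TruncExt.Hom.hom g)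
  have ha' {X Y Z : TruncExt n B} (f : X ⟶ Y) (g : Y ⟶ Z) (k : ℕ) (hk : k ≤ n) :
      TruncExt.coeff (a f g) k = φ k (TruncExt.Hom.hom f) (TruncExt.Hom.hom g) :=
    TruncExt.coeff_ofCoeff _ hk
  have ha₀ {X Y Z : TruncExt n B} (f : X ⟶ Y) (g : Y ⟶ Z) : TruncExt.coeff (a f g) 0 =
      (F.mapComp (TruncExt.Hom.hom f) (TruncExt.Hom.hom g)).inv := by
    rw [ha' f g 0 (Nat.zero_le n), h₀]
    rfl
  have hiso {X Y Z : TruncExt n B} (f : X ⟶ Y) (g : Y ⟶ Z) : IsIso (a f g) := by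
    refine TruncExt.isIso_of_isIso_coeff_zero _ ?_
    rw [ha₀]
    exact inferInstanceAs (IsIso (F.mapComp (TruncExt.Hom.hom f) (TruncExt.Hom.hom g)).inv)
  obtain ⟨S, hS⟩ := exists_pseudofunctorialStructure (P := truncMap K F n)
    (fun f g => (asIso (a f g)).symm)
    (fun {X Y Z} f {g h} η => by
      change _ ◁ _ ≫ a f h = a f g ≫ _
      refine TruncExt.hom₂_ext fun k => ?_
      rw [TruncExt.coeff_comp, TruncExt.coeff_comp]
      split_ifs with hk
      · rw [← Finset.Nat.sum_antidiagonal_swap]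
        refine Finset.sum_congr rfl fun p hp => ?_
        rw [Prod.fst_swap, Prod.snd_swap, ha' f h _ ((Finset.HasAntidiagonal.antidiagonal.fst_le hp).trans hk),
          ha' f g _ ((Finset.HasAntidiagonal.antidiagonal.fst_le hp).trans hk)]
        exact (hφ p.1).nat₂ _ _
      · rfl)
    (fun {X Y Z f g} η h => by
      change _ ▷ _ ≫ a g h = a f h ≫ _
      refine TruncExt.hom₂_ext fun k => ?_
      rw [TruncExt.coeff_comp, TruncExt.coeff_comp]
      split_ifs with hk
      · rw [← Finset.Nat.sum_antidiagonal_swap]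
        refine Finset.sum_congr rfl fun p hp => ?_
        rw [Prod.fst_swap, Prod.snd_swap, ha' g h _ ((Finset.HasAntidiagonal.antidiagonal.fst_le hp).trans hk),
          ha' f h _ ((Finset.HasAntidiagonal.antidiagonal.fst_le hp).trans hk)]
        exact (hφ p.1).nat₁ _ _
      · rfl)
    (fun f g l => (hexagon_truncMap_iff K a φ ha' f g l).mpr fun k hk => by
      rw [ha k hk]
      rfl)
    -- The constant unit of `F` only witnesses that identities go to 1-morphisms isomorphic to
    -- identities; the unit of `S` may have terms of higher order.
    (fun X => TruncExt.constIso (F.mapId X.obj))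
  have hinv {X Y Z : TruncExt n B} (f : X ⟶ Y) (g : Y ⟶ Z) : (S.mapComp f g).inv = a f g := by
    rw [hS]
    rfl
  refine ⟨{ S with coeff_zero_mapComp := fun f g => ?_, coeff_zero_mapId := fun X => ?_ },
    fun k hk => ?_⟩
  · rw [hinv, ha₀]
  -- The constant term of the new unit and the unit of `F` both solve the left unit axiom of `F` at
  -- the identity, so uniqueness identifies them.
  · refine eq_of_whiskerRight_map_id ((coeff_mapId_whiskerRight S X.obj 0).trans ?_)
    rw [hinv, ha₀]
    exact (Iso.inv_comp_eq _).mpr (F.map₂_left_unitor (𝟙 X.obj))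
  · funext X Y Z f g
    exact (congrArg (fun θ => TruncExt.coeff θ k) (hinv (lift n f) (lift n g))).trans
      (ha' (lift n f) (lift n g) k hk)

end NthOrderDeformation

/-! ### The obstruction -/

/-- Separates the products of known coefficients, which form the obstruction, from the two terms
that contain the coefficient of order `n + 1`. -/
lemma sum_antidiagonal_succ_eq_sum_filter {M : Type*} [AddCommMonoid M] (G : ℕ × ℕ → M) (n : ℕ) :
    ∑ p ∈ antidiagonal (n + 1), G p =
      ∑ p ∈ (antidiagonal (n + 1)).filter (fun p => p.1 ≤ n ∧ p.2 ≤ n), G p +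
        (G (0, n + 1) + G (n + 1, 0)) := by
  rw [← Finset.sum_filter_add_sum_filter_not _ (fun p : ℕ × ℕ => p.1 ≤ n ∧ p.2 ≤ n)]
  have : (antidiagonal (n + 1)).filter (fun p : ℕ × ℕ => ¬(p.1 ≤ n ∧ p.2 ≤ n)) =
      {(0, n + 1), (n + 1, 0)} := by
    ext ⟨a, b⟩
    simp only [Finset.mem_filter, mem_antidiagonal, Finset.mem_insert, Finset.mem_singleton,
      Prod.mk.injEq]
    omega
  rw [this, Finset.sum_pair (by simp)]

/-- The underlying family of an element of `X³(F)` as an additive map. -/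
def X₃.famHom {B : Type u₁} [Bicategory.{w₁, v₁} B] {C : Type u₂} [Bicategory.{w₂, v₂} C]
    [PreadditiveBicategory C] (F : Pseudofunctor B C) : X₃ F →+ Fam₃ F :=
  AddMonoidHom.mk' X₃.fam X₃.fam_add

namespace NthOrderDeformation

variable {K : Type uK} [Field K]
  {B : Type u₁} [Bicategory.{w₁, v₁} B] [PreadditiveBicategory B] [LinearBicategory K B]
  {C : Type u₂} [Bicategory.{w₂, v₂} C] [PreadditiveBicategory C] [LinearBicategory K C]
  {F : Pseudofunctor B C} [LinearPseudofunctor K F] {n : ℕ}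

lemma fam_obstruction (D : NthOrderDeformation K F n) : D.obstruction.fam =
    ∑ p ∈ (antidiagonal (n + 1)).filter (fun p => p.1 ≤ n ∧ p.2 ≤ n),
      (compL (D.hatCoeff p.1) (D.hatCoeff p.2) - compR (D.hatCoeff p.1) (D.hatCoeff p.2)) := by
  change X₃.famHom F D.obstruction = _
  rw [obstruction, map_sub, map_sum, map_sum, Finset.sum_sub_distrib]
  rfl

/-- The defect of the associativity axiom in order `n + 1`, for a series that continues a
deformation of order `n`. -/
lemma assocDefect_succ (D : NthOrderDeformation K F n) {φ : ℕ → Fam₂ F}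
    (h : ∀ k ≤ n, φ k = D.hatCoeff k) : assocDefect φ (n + 1) = D.obstruction.fam -
      (compR (hat F) (φ (n + 1)) - compL (φ (n + 1)) (hat F) + compR (φ (n + 1)) (hat F) -
        compL (hat F) (φ (n + 1))) := by
  have h₀ : φ 0 = hat F := (h 0 (Nat.zero_le n)).trans D.hatCoeff_zero
  rw [assocDefect, sum_antidiagonal_succ_eq_sum_filter, fam_obstruction, h₀]
  have : ∀ p ∈ (antidiagonal (n + 1)).filter (fun p : ℕ × ℕ => p.1 ≤ n ∧ p.2 ≤ n),
      compL (φ p.1) (φ p.2) - compR (φ p.1) (φ p.2) =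
        compL (D.hatCoeff p.1) (D.hatCoeff p.2) - compR (D.hatCoeff p.1) (D.hatCoeff p.2) := by
    intro p hp
    obtain ⟨-, h₁, h₂⟩ := Finset.mem_filter.mp hp
    rw [h _ h₁, h _ h₂]
  rw [Finset.sum_congr rfl this]
  -- The pairs (0, n + 1) and (n + 1, 0) each contribute a `compL` and a `compR` term; together
  -- these four are the coboundary of `φ (n + 1)` with the opposite sign.
  abel

/-- The coefficient of order `n + 1` of `D` is zero by truncation, so the coboundary term of the
defect disappears. -/
lemma assocDefect_hatCoeff_succ (D : NthOrderDeformation K F n) :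
    assocDefect D.hatCoeff (n + 1) = D.obstruction.fam := by
  have hz := (d₂ K F).map_zero
  rw [D.assocDefect_succ fun _ _ => rfl, D.hatCoeff_eq_zero (Nat.lt_succ_self n)]
  exact (congrArg (fun χ : X₃ F => D.obstruction.fam - χ.fam) hz).trans (sub_zero _)

/-- The obstruction is a 3-cocycle. -/
theorem obstruction_mem_ker (D : NthOrderDeformation K F n) :
    D.obstruction ∈ LinearMap.ker (d₃ K F) := by
  refine X₄.ext ?_
  have h := cofaceSum_assocDefect_eq_zero D.isNat_hatCoeff (k := n + 1)
    fun j hj => D.assocDefect_hatCoeff (Nat.lt_succ_iff.mp hj)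
  rw [assocDefect_hatCoeff_succ, hatCoeff_zero] at h
  -- With padding F̂, the alternating sum `cofaceSum` is by definition the coboundary on X³.
  exact h

/-- The extensions of a deformation to order `n + 1` are the cochains whose coboundary is the
obstruction. -/
theorem exists_extends_iff (D : NthOrderDeformation K F n) (φ : X₂ F) :
    (∃ D' : NthOrderDeformation K F (n + 1), D'.Extends D ∧ D'.cochain (n + 1) = φ) ↔
      d₂ K F φ = D.obstruction := by
  constructor
  · rintro ⟨D', hD, rfl⟩
    refine X₃.ext ?_
    have h := D'.assocDefect_hatCoeff le_rfl
    rw [D.assocDefect_succ fun k hk => (hD k hk).1, sub_eq_zero] at h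
    exact h.symm
  · intro hφ
    -- The given series with `φ` as its coefficient of order `n + 1`.
    let ψ (k : ℕ) : Fam₂ F := if k = n + 1 then φ.fam else D.hatCoeff k
    have hψ (k : ℕ) (hk : k ≤ n) : ψ k = D.hatCoeff k := if_neg (by omega)
    have hψ' : ψ (n + 1) = φ.fam := if_pos rfl
    obtain ⟨D', hD'⟩ := exists_hatCoeff_eq (K := K) (n := n + 1) ψ
      (fun k => by
        by_cases hk : k = n + 1
        · rw [hk, hψ']
          exact φ.isNat
        · rw [show ψ k = D.hatCoeff k from if_neg hk]
          exact D.isNat_hatCoeff k)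
      ((hψ 0 (Nat.zero_le n)).trans D.hatCoeff_zero)
      (fun k hk => by
        rcases Nat.lt_or_eq_of_le hk with hk | rfl
        -- A defect of order at most `n` involves only coefficients of order at most `n`, and these
        -- are unchanged.
        · rw [← D.assocDefect_hatCoeff (Nat.lt_succ_iff.mp hk)]
          refine Finset.sum_congr rfl fun p hp => ?_
          rw [mem_antidiagonal] at hp
          rw [hψ _ (by omega), hψ _ (by omega)]
        · rw [D.assocDefect_succ hψ, hψ', sub_eq_zero, ← hφ]
          rfl)
    have hD (k : ℕ) (hk : k ≤ n) : D'.hatCoeff k = D.hatCoeff k :=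
      (hD' k (by omega)).trans (hψ k hk)
    exact ⟨D', fun k hk => ⟨hD k hk, unitCoeff_eq (hD k hk)⟩,
      X₂.ext ((hD' (n + 1) le_rfl).trans hψ')⟩

/-- A deformation whose obstruction is cohomologous to zero extends to the next order. -/
theorem exists_extends_of_classOf_eq_zero (D : NthOrderDeformation K F n)
    (h : classOf K F ⟨D.obstruction, D.obstruction_mem_ker⟩ = 0) :
    ∃ D' : NthOrderDeformation K F (n + 1), D'.Extends D := by
  -- The class vanishes when Ψ is a coboundary; any cochain `φ` with δφ = Ψ serves as the new
  -- coefficient.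
  obtain ⟨φ, hφ⟩ := (Submodule.Quotient.mk_eq_zero _).mp h
  obtain ⟨D', hD', -⟩ := (D.exists_extends_iff φ).mpr (congrArg Subtype.val hφ)
  exact ⟨D', hD'⟩

end NthOrderDeformation

end PseudoDeformation

theorem theorem8p1 {K : Type*} [Field K]
    {B : Type*} [CategoryTheory.Bicategory B] [CategoryTheory.Bicategory.Strict B]
    [PseudoDeformation.PreadditiveBicategory B] [PseudoDeformation.LinearBicategory K B]
    {C : Type*} [CategoryTheory.Bicategory C] [CategoryTheory.Bicategory.Strict C]
    [PseudoDeformation.PreadditiveBicategory C] [PseudoDeformation.LinearBicategory K C]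
    (F : CategoryTheory.StrictlyUnitaryPseudofunctor B C)
    [PseudoDeformation.LinearPseudofunctor K F.toPseudofunctor] (n : ℕ)
    (D : PseudoDeformation.NthOrderDeformation K F.toPseudofunctor n) :
    ∃ hΨ : D.obstruction ∈ LinearMap.ker (PseudoDeformation.d₃ K F.toPseudofunctor),
      (∀ φ : PseudoDeformation.X₂ F.toPseudofunctor,
        (∃ D' : PseudoDeformation.NthOrderDeformation K F.toPseudofunctor (n + 1),
          D'.Extends D ∧ D'.cochain (n + 1) = φ) ↔
        PseudoDeformation.d₂ K F.toPseudofunctor φ = D.obstruction) ∧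
      (PseudoDeformation.classOf K F.toPseudofunctor ⟨D.obstruction, hΨ⟩ = 0 →
        ∃ D' : PseudoDeformation.NthOrderDeformation K F.toPseudofunctor (n + 1),
          D'.Extends D) :=
  ⟨D.obstruction_mem_ker, D.exists_extends_iff, D.exists_extends_of_classOf_eq_zero⟩
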